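/- Let $L,\rho,\mu,\alpha_1,\beta,l_1,l_2,\eta>0$, $\gamma\in\mathbb R$, $\alpha=\alpha_1+\gamma^2\beta$, $a\in(0,1)$, and put $\mu(\xi)=|\xi|^{(2a-1)/2}$ for $\xi\in\mathbb R$ (a function, not to be confused with the constant $\mu$). Let $H^1_*(0,L)=\{f\in H^1(0,L): f(0)=0\}$ (complex valued functions) and $$\mathcal H=H^1_*(0,L)\times L^2(0,L)\times L^2(\mathbb R)\times H^1_*(0,L)\times L^2(0,L)\times L^2(\mathbb R),$$ with the inner product, for $U_i=(V_i,f_i,\phi_{1,i},P_i,g_i,\phi_{2,i})$, $$\langle U_1,U_2\rangle=\int_0^L\big[\rho f_1\overline{f_2}+\mu g_1\overline{g_2}+\alpha_1V_{1,x}\overline{V_{2,x}}+\beta(\gamma V_{1,x}-P_{1,x})\overline{(\gamma V_{2,x}-P_{2,x})}\big]dx+\frac{\sin(a\pi)}{\pi}\int_{\mathbb R}\big(l_1\phi_{1,1}\overline{\phi_{1,2}}+l_2\phi_{2,1}\overline{\phi_{2,2}}\big)d\xi .$$ Let $\mathcal A$ be the operator in $\mathcal H$ given for $U=(V,f,\phi_1,P,g,\phi_2)$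 by $$\mathcal AU=\Big(f,\ \tfrac{\alpha}{\rho}V_{xx}-\tfrac{\gamma\beta}{\rho}P_{xx},\ -(\xi^2+\eta)\phi_1+f(L)\mu(\xi),\ g,\ -\tfrac{\gamma\beta}{\mu}V_{xx}+\tfrac{\beta}{\mu}P_{xx},\ -(\xi^2+\eta)\phi_2+g(L)\mu(\xi)\Big)$$ (where the denominators $\mu$ are the constant), whose domain $\mathcal D(\mathcal A)$ is the set of all $U\in\mathcal H$ with $V,P\in H^2(0,L)\cap H^1_*(0,L)$, $f,g\in H^1_*(0,L)$, $|\xi|\phi_1,\ |\xi|\phi_2,\ -(\xi^2+\eta)\phi_1+f(L)\mu(\xi),\ -(\xi^2+\eta)\phi_2+g(L)\mu(\xi)\in L^2(\mathbb R)$ and $$\alpha V_x(L)-\gamma\beta P_x(L)=-l_1\frac{\sin(a\pi)}{\pi}\int_{\mathbb R}\mu(\xi)\phi_1(\xi)\,d\xi,\qquad \beta P_x(L)-\gamma\beta V_x(L)=-l_2\frac{\sin(a\pi)}{\pi}\int_{\mathbb R}\mu(\xi)\phi_2(\xi)\,d\xi .$$ Theorem. $\mathcal A$ is the infinitesimal generator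 of a $C_0$-semigroup of contractions $\{\mathcal S_{\mathcal A}(t)\}_{t\ge0}$ on $\mathcal H$, and for every $U_0\in\mathcal D(\mathcal A)$ the problem $U_t=\mathcal AU$ on $[0,\infty)$, $U(0)=U_0$, has a unique solution, namely $U(t)=\mathcal S_{\mathcal A}(t)U_0$, and $$U\in C([0,\infty);\mathcal D(\mathcal A))\cap C^1([0,\infty);\mathcal H),$$ where $\mathcal D(\mathcal A)$ carries the graph norm. Here a solution is a function $U:[0,\infty)\to\mathcal H$, differentiable in $\mathcal H$ (one-sidedly at $0$), with $U(t)\in\mathcal D(\mathcal A)$ and $U_t(t)=\mathcal AU(t)$ for all $t\ge0$ and $U(0)=U_0$. -/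

import Mathlib

open MeasureTheory Set Filter Topology
open scoped ContDiff

namespace PiezoBeam

/-- `L²(0,L)`, complex valued. -/
abbrev L2I (L : ℝ) : Type := Lp ℂ 2 (volume.restrict (Ioo (0 : ℝ) L))

/-- `L²(-∞,∞)`, complex valued. -/
abbrev L2R : Type := Lp ℂ 2 (volume : Measure ℝ)

/-- Smooth functions with compact support inside `(0,L)`. -/
structure IsTest (L : ℝ) (φ : ℝ → ℝ) : Prop where
  smooth : ContDiff ℝ ∞ φ
  compact : HasCompactSupport φ
  supp : tsupport φ ⊆ Ioo 0 L

/-- `w` is the weak derivative of `u` on `(0,L)`. -/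
def IsWeakDeriv {L : ℝ} (u w : L2I L) : Prop :=
  ∀ φ : ℝ → ℝ, IsTest L φ →
    ∫ x in Ioo 0 L, deriv φ x • u x = - ∫ x in Ioo 0 L, φ x • w x

theorem L2I.integrable {L : ℝ} (u : L2I L) :
    Integrable u (volume.restrict (Ioo (0 : ℝ) L)) :=
  (Lp.memLp u).integrable (by norm_num)

theorem IsTest.integrable_smul {L : ℝ} {φ : ℝ → ℝ} (h : IsTest L φ) {f : ℝ → ℂ} {ν : Measure ℝ}
    (hf : Integrable f ν) : Integrable (fun x => φ x • f x) ν := by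
  obtain ⟨C, hC⟩ := h.compact.exists_bound_of_continuous h.smooth.continuous
  exact hf.bdd_smul C h.smooth.continuous.aestronglyMeasurable (Eventually.of_forall hC)

theorem IsTest.deriv {L : ℝ} {φ : ℝ → ℝ} (h : IsTest L φ) : IsTest L (deriv φ) where
  smooth := by
    have := h.smooth
    exact (contDiff_infty_iff_deriv.1 this).2
  compact := h.compact.deriv
  supp := (tsupport_deriv_subset).trans h.supp

theorem IsWeakDeriv.unique {L : ℝ} {u w w' : L2I L} (h : IsWeakDeriv u w)
    (h' : IsWeakDeriv u w') : w = w' := by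
  have key : ∀ᵐ x ∂(volume.restrict (Ioo (0 : ℝ) L)), x ∈ Ioo 0 L → (w x - w' x) = 0 := by
    apply isOpen_Ioo.ae_eq_zero_of_integral_contDiff_smul_eq_zero
    · exact (w.integrable.sub w'.integrable).locallyIntegrable.locallyIntegrableOn _
    · intro φ h1 h2 h3
      have hφ : IsTest L φ := ⟨h1, h2, h3⟩
      have := (h φ hφ).symm.trans (h' φ hφ)
      simp only [smul_sub]
      rw [integral_sub (hφ.integrable_smul w.integrable) (hφ.integrable_smul w'.integrable)]
      rw [neg_inj.1 this, sub_self]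
  apply Lp.ext
  filter_upwards [key, ae_restrict_mem measurableSet_Ioo] with x hx hx'
  exact sub_eq_zero.1 (hx hx')

theorem IsWeakDeriv.add {L : ℝ} {u u' w w' : L2I L} (h : IsWeakDeriv u w)
    (h' : IsWeakDeriv u' w') : IsWeakDeriv (u + u') (w + w') := by
  intro φ hφ
  have e1 : ∫ x in Ioo 0 L, _root_.deriv φ x • (u + u') x
      = ∫ x in Ioo 0 L, (_root_.deriv φ x • u x + _root_.deriv φ x • u' x) := by
    apply integral_congr_ae
    filter_upwards [Lp.coeFn_add u u'] with x hx
    rw [hx, Pi.add_apply, smul_add]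
  have e2 : ∫ x in Ioo 0 L, φ x • (w + w') x = ∫ x in Ioo 0 L, (φ x • w x + φ x • w' x) := by
    apply integral_congr_ae
    filter_upwards [Lp.coeFn_add w w'] with x hx
    rw [hx, Pi.add_apply, smul_add]
  rw [e1, e2, integral_add (hφ.deriv.integrable_smul u.integrable)
    (hφ.deriv.integrable_smul u'.integrable), integral_add (hφ.integrable_smul w.integrable)
    (hφ.integrable_smul w'.integrable), h φ hφ, h' φ hφ]
  ring

theorem IsWeakDeriv.smul {L : ℝ} {u w : L2I L} (c : ℂ) (h : IsWeakDeriv u w) :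
    IsWeakDeriv (c • u) (c • w) := by
  intro φ hφ
  have e1 : ∫ x in Ioo 0 L, _root_.deriv φ x • (c • u) x
      = ∫ x in Ioo 0 L, c • (_root_.deriv φ x • u x) := by
    apply integral_congr_ae
    filter_upwards [Lp.coeFn_smul c u] with x hx
    rw [hx, Pi.smul_apply, smul_comm]
  have e2 : ∫ x in Ioo 0 L, φ x • (c • w) x = ∫ x in Ioo 0 L, c • (φ x • w x) := by
    apply integral_congr_ae
    filter_upwards [Lp.coeFn_smul c w] with x hx
    rw [hx, Pi.smul_apply, smul_comm]
  rw [e1, e2, integral_smul, integral_smul, h φ hφ, smul_neg]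

theorem IsWeakDeriv.zero {L : ℝ} : IsWeakDeriv (0 : L2I L) 0 := by
  intro φ hφ
  have e : ∀ ψ : ℝ → ℝ, ∫ x in Ioo 0 L, ψ x • (0 : L2I L) x = 0 := by
    intro ψ
    apply integral_eq_zero_of_ae
    filter_upwards [Lp.coeFn_zero ℂ 2 (volume.restrict (Ioo (0 : ℝ) L))] with x hx
    rw [hx]; simp
  rw [e, e, neg_zero]

/-- The lemma of du Bois-Reymond on `(0,L)`. -/
theorem ae_const_of_forall_test {L : ℝ} (hL : 0 < L) {f : ℝ → ℂ}
    (hf : Integrable f (volume.restrict (Ioo (0 : ℝ) L)))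
    (h : ∀ φ : ℝ → ℝ, IsTest L φ → ∫ x in Ioo 0 L, deriv φ x • f x = 0) :
    ∃ c : ℂ, ∀ᵐ x ∂(volume.restrict (Ioo (0 : ℝ) L)), f x = c := by
  let b : ContDiffBump (L / 2 : ℝ) := ⟨L / 8, L / 4, by positivity, by linarith⟩
  let χ : ℝ → ℝ := b.normed volume
  have hχ : IsTest L χ := by
    refine ⟨b.contDiff_normed, b.hasCompactSupport_normed, ?_⟩
    rw [b.tsupport_normed_eq, Real.closedBall_eq_Icc]
    intro x hx
    have h1 : L / 2 - L / 4 ≤ x := hx.1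
    have h2 : x ≤ L / 2 + L / 4 := hx.2
    exact ⟨by linarith, by linarith⟩
  have hχ1 : ∫ x, χ x = 1 := b.integral_normed
  let c : ℂ := ∫ x in Ioo 0 L, χ x • f x
  refine ⟨c, ?_⟩
  have : IsFiniteMeasure (volume.restrict (Ioo (0 : ℝ) L)) := inferInstance
  have key : ∀ᵐ x ∂(volume.restrict (Ioo (0 : ℝ) L)), x ∈ Ioo 0 L → (f x - c) = 0 := by
    apply isOpen_Ioo.ae_eq_zero_of_integral_contDiff_smul_eq_zero
    · exact (hf.sub (integrable_const c)).locallyIntegrable.locallyIntegrableOn _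
    intro ψ h1 h2 h3
    have hψ : IsTest L ψ := ⟨h1, h2, h3⟩
    set m : ℝ := ∫ x, ψ x with hm
    let g : ℝ → ℝ := fun x => ψ x - m * χ x
    have hg : ContDiff ℝ ∞ g := hψ.smooth.sub (contDiff_const.mul hχ.smooth)
    let K := tsupport ψ ∪ tsupport χ
    have hK : IsCompact K := hψ.compact.isCompact.union hχ.compact.isCompact
    have hKs : K ⊆ Ioo 0 L := union_subset hψ.supp hχ.supp
    have hKne : K.Nonempty := by
      have : (L / 2) ∈ tsupport χ := by
        apply subset_tsupport
        rw [b.support_normed_eq]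
        exact Metric.mem_ball_self b.rOut_pos
      exact ⟨_, Or.inr this⟩
    obtain ⟨p, hp⟩ := hK.exists_isLeast hKne
    obtain ⟨q, hq⟩ := hK.exists_isGreatest hKne
    have hp0 := (hKs hp.1).1
    have hqL := (hKs hq.1).2
    have hg0 : ∀ x, x ∉ Icc p q → g x = 0 := by
      intro x hx
      have hxK : x ∉ K := fun hxK => hx ⟨hp.2 hxK, hq.2 hxK⟩
      have a1 : ψ x = 0 := image_eq_zero_of_notMem_tsupport fun h => hxK (Or.inl h)
      have a2 : χ x = 0 := image_eq_zero_of_notMem_tsupport fun h => hxK (Or.inr h)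
      simp [g, a1, a2]
    have hgint : ∫ x, g x = 0 := by
      have i1 : Integrable ψ := hψ.smooth.continuous.integrable_of_hasCompactSupport hψ.compact
      have i2 : Integrable χ := hχ.smooth.continuous.integrable_of_hasCompactSupport hχ.compact
      simp only [g]
      rw [integral_sub i1 (i2.const_mul m), integral_const_mul, hχ1, ← hm]; ring
    let Φ : ℝ → ℝ := fun x => ∫ t in (0 : ℝ)..x, g t
    have hΦd : ∀ x, HasDerivAt Φ (g x) x := fun x =>
      (hg.continuous.integral_hasStrictDerivAt 0 x).hasDerivAt
    have hΦ' : deriv Φ = g := funext fun x => (hΦd x).deriv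
    have hΦs : ContDiff ℝ ∞ Φ := by
      rw [contDiff_infty_iff_deriv]
      exact ⟨fun x => (hΦd x).differentiableAt, by rw [hΦ']; exact hg⟩
    have hΦ0 : Function.support Φ ⊆ Icc p q := by
      intro x hx
      by_contra hxn
      apply hx
      simp only [Φ]
      by_cases hxp : x < p
      · apply intervalIntegral.integral_zero_ae
        refine Eventually.of_forall fun t ht => hg0 t fun ht' => ?_
        rcases le_total 0 x with h0 | h0
        · rw [uIoc_of_le h0] at ht; linarith [ht.2, ht'.1]
        · rw [uIoc_of_ge h0] at ht; linarith [ht.2, ht'.1]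
      · have hqx : q < x := by
          by_contra hh; exact hxn ⟨not_lt.1 hxp, not_lt.1 hh⟩
        have h0x : 0 ≤ x := by linarith [not_lt.1 hxp]
        rw [intervalIntegral.integral_of_le h0x, setIntegral_eq_integral_of_forall_compl_eq_zero,
          hgint]
        intro t ht
        apply hg0
        intro ht'
        exact ht ⟨by linarith [ht'.1], by linarith [ht'.2]⟩
    have hΦt : IsTest L Φ := by
      have hsub : tsupport Φ ⊆ Icc p q := closure_minimal hΦ0 isClosed_Icc
      refine ⟨hΦs, isCompact_Icc.of_isClosed_subset (isClosed_tsupport _) hsub, hsub.trans ?_⟩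
      intro x hx
      exact ⟨by linarith [hx.1], by linarith [hx.2]⟩
    have hz := h Φ hΦt
    rw [hΦ'] at hz
    have i1 := hψ.integrable_smul hf
    have i2 := hχ.integrable_smul hf
    have hz' : ∫ x in Ioo 0 L, ψ x • f x = (m : ℂ) * c := by
      have : ∫ x in Ioo 0 L, g x • f x
          = ∫ x in Ioo 0 L, (ψ x • f x - (m : ℂ) * (χ x • f x)) := by
        apply integral_congr_ae
        refine Eventually.of_forall fun x => ?_
        simp only [g, Complex.real_smul]; push_cast; ring
      rw [this, integral_sub i1 (i2.const_mul _), integral_const_mul] at hz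
      exact sub_eq_zero.1 hz
    have hψm : ∫ x in Ioo 0 L, ψ x = m := by
      rw [hm]
      apply setIntegral_eq_integral_of_forall_compl_eq_zero
      intro x hx
      exact image_eq_zero_of_notMem_tsupport fun h => hx (hψ.supp h)
    simp only [smul_sub]
    rw [integral_sub i1 (hψ.integrable_smul (integrable_const c)), hz']
    rw [integral_smul_const, hψm, Complex.real_smul, sub_self]
  filter_upwards [key, ae_restrict_mem measurableSet_Ioo] with x hx hx'
  exact sub_eq_zero.1 (hx hx')


theorem integral_deriv_mul_primitive {L : ℝ} {f : ℝ → ℝ}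
    (hf : IntervalIntegrable f volume 0 L) {φ : ℝ → ℝ} (hφ : IsTest L φ) :
    ∫ x in (0 : ℝ)..L, deriv φ x * (∫ t in (0 : ℝ)..x, f t) = - ∫ x in (0 : ℝ)..L, φ x * f x := by
  have hF := hf.absolutelyContinuousOnInterval_intervalIntegral (c := 0) (by simp)
  have hφa : AbsolutelyContinuousOnInterval φ 0 L :=
    ((hφ.smooth.of_le (by norm_cast : (1 : WithTop ℕ∞) ≤ (⊤ : ℕ∞))).contDiffOn
      ).absolutelyContinuousOnInterval
  have h := hF.integral_mul_deriv_eq_deriv_mul hφa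
  have h0 : φ 0 = 0 :=
    image_eq_zero_of_notMem_tsupport fun h => (lt_irrefl _ (hφ.supp h).1)
  have h1 : φ L = 0 :=
    image_eq_zero_of_notMem_tsupport fun h => (lt_irrefl _ (hφ.supp h).2)
  rw [h0, h1, mul_zero, mul_zero, sub_zero, zero_sub] at h
  have e1 : ∫ x in (0 : ℝ)..L, deriv φ x * (∫ t in (0 : ℝ)..x, f t)
      = ∫ x in (0 : ℝ)..L, (∫ t in (0 : ℝ)..x, f t) * deriv φ x := by
    simp_rw [mul_comm]
  rw [e1, h]
  congr 1
  apply intervalIntegral.integral_congr_ae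
  filter_upwards [hf.ae_hasDerivAt_integral] with x hx hx'
  rw [(hx (uIoc_subset_uIcc hx') 0 (by simp)).deriv, mul_comm]

/-- Every `u ∈ H¹(0,L)` has a representative continuous on `[0,L]`, which is the primitive of the
weak derivative up to a constant. -/
theorem IsWeakDeriv.exists_primitive {L : ℝ} (hL : 0 < L) {u w : L2I L} (h : IsWeakDeriv u w) :
    ∃ c : ℂ, (u : ℝ → ℂ) =ᵐ[volume.restrict (Ioo (0 : ℝ) L)]
      fun x => c + ∫ t in (0 : ℝ)..x, w t := by
  have hwi : IntervalIntegrable w volume 0 L := by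
    rw [intervalIntegrable_iff_integrableOn_Ioo_of_le hL.le]; exact w.integrable
  let W : ℝ → ℂ := fun x => ∫ t in (0 : ℝ)..x, w t
  have hWc : ContinuousOn W (Icc 0 L) := by
    have := intervalIntegral.continuousOn_primitive_interval' hwi (a := 0) (by simp)
    rwa [uIcc_of_le hL.le] at this
  have hWi : Integrable W (volume.restrict (Ioo (0 : ℝ) L)) :=
    (hWc.integrableOn_Icc).mono_set Ioo_subset_Icc_self
  have hparts : ∀ φ : ℝ → ℝ, IsTest L φ →
      ∫ x in Ioo 0 L, deriv φ x • W x = - ∫ x in Ioo 0 L, φ x • w x := by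
    intro φ hφ
    have cl : ∀ T : ℂ →L[ℝ] ℝ, T (∫ x in Ioo 0 L, deriv φ x • W x)
        = T (- ∫ x in Ioo 0 L, φ x • w x) := by
      intro T
      have hTi : IntervalIntegrable (fun x => T (w x)) volume 0 L :=
        ⟨T.integrable_comp hwi.1, T.integrable_comp hwi.2⟩
      have := integral_deriv_mul_primitive hTi hφ
      rw [map_neg, ← T.integral_comp_comm (hφ.deriv.integrable_smul hWi),
        ← T.integral_comp_comm (hφ.integrable_smul w.integrable)]
      rw [intervalIntegral.integral_of_le hL.le, intervalIntegral.integral_of_le hL.le,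
        integral_Ioc_eq_integral_Ioo, integral_Ioc_eq_integral_Ioo] at this
      simp only [map_smul, smul_eq_mul]
      rw [← this]
      apply setIntegral_congr_fun measurableSet_Ioo
      intro x hx
      simp only [W]
      congr 1
      have : IntervalIntegrable w volume 0 x := hwi.mono_set (by
        rw [uIcc_of_le hL.le, uIcc_of_le hx.1.le]; exact Icc_subset_Icc_right hx.2.le)
      exact (T.intervalIntegral_comp_comm this).symm
    exact Complex.ext (cl Complex.reCLM) (cl Complex.imCLM)
  obtain ⟨c, hc⟩ := ae_const_of_forall_test hL (u.integrable.sub hWi) (by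
    intro φ hφ
    simp only [Pi.sub_apply, smul_sub]
    rw [integral_sub (hφ.deriv.integrable_smul u.integrable) (hφ.deriv.integrable_smul hWi),
      h φ hφ, hparts φ hφ, sub_self])
  refine ⟨c, ?_⟩
  filter_upwards [hc] with x hx
  simp only [Pi.sub_apply] at hx
  rw [← hx]; simp [W]

/-- `v` is the representative of `u` that is continuous on `[0,L]`. -/
def IsContRep {L : ℝ} (u : L2I L) (v : ℝ → ℂ) : Prop :=
  ContinuousOn v (Icc 0 L) ∧ (u : ℝ → ℂ) =ᵐ[volume.restrict (Ioo (0 : ℝ) L)] v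

theorem IsWeakDeriv.exists_contRep {L : ℝ} (hL : 0 < L) {u w : L2I L} (h : IsWeakDeriv u w) :
    ∃ v, IsContRep u v := by
  obtain ⟨c, hc⟩ := h.exists_primitive hL
  refine ⟨_, ?_, hc⟩
  have hwi : IntervalIntegrable w volume 0 L := by
    rw [intervalIntegrable_iff_integrableOn_Ioo_of_le hL.le]; exact w.integrable
  have := intervalIntegral.continuousOn_primitive_interval' hwi (a := 0) (by simp)
  rw [uIcc_of_le hL.le] at this
  exact continuousOn_const.add this

theorem IsContRep.eqOn {L : ℝ} (hL : 0 < L) {u : L2I L} {v v' : ℝ → ℂ} (h : IsContRep u v)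
    (h' : IsContRep u v') : EqOn v v' (Icc 0 L) := by
  have h1 : EqOn v v' (Ioo 0 L) := by
    apply Measure.eqOn_open_of_ae_eq (h.2.symm.trans h'.2) isOpen_Ioo
      (h.1.mono Ioo_subset_Icc_self) (h'.1.mono Ioo_subset_Icc_self)
  refine h1.of_subset_closure h.1 h'.1 Ioo_subset_Icc_self ?_
  rw [closure_Ioo hL.ne]

theorem IsContRep.add {L : ℝ} {u u' : L2I L} {v v' : ℝ → ℂ} (h : IsContRep u v)
    (h' : IsContRep u' v') : IsContRep (u + u') (v + v') :=
  ⟨h.1.add h'.1, (Lp.coeFn_add u u').trans (h.2.add h'.2)⟩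

theorem IsContRep.smul {L : ℝ} {u : L2I L} {v : ℝ → ℂ} (c : ℂ) (h : IsContRep u v) :
    IsContRep (c • u) (c • v) :=
  ⟨h.1.const_smul c, (Lp.coeFn_smul c u).trans (h.2.const_smul c)⟩

theorem IsContRep.zero {L : ℝ} : IsContRep (0 : L2I L) 0 :=
  ⟨continuousOn_const, Lp.coeFn_zero _ _ _⟩

/-- The Sobolev space `H¹(0,L)`: square integrable functions with a square integrable weak
derivative. -/
def H1 (L : ℝ) : Submodule ℂ (L2I L) where
  carrier := {u | ∃ w, IsWeakDeriv u w}
  add_mem' := by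
    rintro u u' ⟨w, h⟩ ⟨w', h'⟩
    exact ⟨_, h.add h'⟩
  zero_mem' := ⟨0, IsWeakDeriv.zero⟩
  smul_mem' := by
    rintro c u ⟨w, h⟩
    exact ⟨_, h.smul c⟩

/-- The weak derivative `u_x` of `u ∈ H¹(0,L)`. -/
noncomputable def wderiv (L : ℝ) : H1 L →ₗ[ℂ] L2I L where
  toFun u := u.2.choose
  map_add' u v := (u + v).2.choose_spec.unique (u.2.choose_spec.add v.2.choose_spec)
  map_smul' c u := (c • u).2.choose_spec.unique (u.2.choose_spec.smul c)

theorem wderiv_spec {L : ℝ} (u : H1 L) : IsWeakDeriv (u : L2I L) (wderiv L u) := u.2.choose_spec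

/-- The continuous representative of `u ∈ H¹(0,L)`. -/
noncomputable def contRep {L : ℝ} (hL : 0 < L) (u : H1 L) : ℝ → ℂ :=
  ((wderiv_spec u).exists_contRep hL).choose

theorem contRep_spec {L : ℝ} (hL : 0 < L) (u : H1 L) : IsContRep (u : L2I L) (contRep hL u) :=
  ((wderiv_spec u).exists_contRep hL).choose_spec

/-- The value at `x ∈ [0,L]` of (the continuous representative of) `u ∈ H¹(0,L)`. -/
noncomputable def evalAt {L : ℝ} (hL : 0 < L) (x : Icc (0 : ℝ) L) : H1 L →ₗ[ℂ] ℂ where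
  toFun u := contRep hL u x
  map_add' u v :=
    (contRep_spec hL (u + v)).eqOn hL ((contRep_spec hL u).add (contRep_spec hL v)) x.2
  map_smul' c u :=
    (contRep_spec hL (c • u)).eqOn hL ((contRep_spec hL u).smul c) x.2

theorem eq_zero_of_wderiv_eq_zero {L : ℝ} (hL : 0 < L) (u : H1 L) (h : wderiv L u = 0)
    (h0 : evalAt hL ⟨0, le_rfl, hL.le⟩ u = 0) : u = 0 := by
  obtain ⟨c, hc⟩ := (wderiv_spec u).exists_primitive hL
  have hc' : ((u : L2I L) : ℝ → ℂ) =ᵐ[volume.restrict (Ioo (0 : ℝ) L)] fun _ => c := by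
    filter_upwards [hc, ae_restrict_mem measurableSet_Ioo] with x hx hx'
    rw [hx, h]
    have : ∫ t in (0 : ℝ)..x, (0 : L2I L) t = 0 := by
      rw [intervalIntegral.integral_of_le hx'.1.le]
      apply integral_eq_zero_of_ae
      exact ae_restrict_of_ae_restrict_of_subset (s := Ioc 0 x) (t := Ioo 0 L)
        (fun y hy => ⟨hy.1, hy.2.trans_lt hx'.2⟩) (Lp.coeFn_zero ℂ 2 _)
    rw [this, add_zero]
  have hrep : IsContRep (u : L2I L) fun _ => c := ⟨continuousOn_const, hc'⟩
  have hc0 : c = 0 := by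
    have := (contRep_spec hL u).eqOn hL hrep (x := 0) ⟨le_rfl, hL.le⟩
    rw [← this]; exact h0
  apply Subtype.ext
  apply Lp.ext
  filter_upwards [hc', Lp.coeFn_zero ℂ 2 (volume.restrict (Ioo (0 : ℝ) L))] with x hx hx'
  rw [hx, hc0]; exact hx'.symm


/-- The space `H¹_*(0,L) = {f ∈ H¹(0,L) : f(0) = 0}`. -/
noncomputable def H1Star {L : ℝ} (hL : 0 < L) : Submodule ℂ (H1 L) :=
  LinearMap.ker (evalAt hL ⟨0, le_rfl, hL.le⟩)

/-- The constants of the beam model: length, mass density, magnetic permeability, elastic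
stiffnesses, impermeability, piezoelectric coefficient, feedback gains, and the order `a` and
weight `η` of the fractional derivative. -/
structure Params where
  L : ℝ
  ρ : ℝ
  μ : ℝ
  α : ℝ
  α₁ : ℝ
  β : ℝ
  γ : ℝ
  l₁ : ℝ
  l₂ : ℝ
  a : ℝ
  η : ℝ
  L_pos : 0 < L
  ρ_pos : 0 < ρ
  μ_pos : 0 < μ
  α₁_pos : 0 < α₁
  β_pos : 0 < β
  α_eq : α = α₁ + γ ^ 2 * β
  l₁_pos : 0 < l₁
  l₂_pos : 0 < l₂
  a_pos : 0 < a
  a_lt_one : a < 1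
  η_pos : 0 < η

variable (p : Params)

/-- The factor `sin(aπ)/π`. -/
noncomputable def Params.κ : ℝ := Real.sin (p.a * Real.pi) / Real.pi

theorem Params.κ_pos : 0 < p.κ := by
  have h1 := p.a_pos
  have h2 := p.a_lt_one
  refine div_pos (Real.sin_pos_of_pos_of_lt_pi (by positivity) ?_) Real.pi_pos
  nlinarith [Real.pi_pos]

/-- The function `μ(ξ) = |ξ|^((2a-1)/2)`. -/
noncomputable def Params.kern (ξ : ℝ) : ℝ := |ξ| ^ ((2 * p.a - 1) / 2)

/-- The state space
`H¹_*(0,L) × L²(0,L) × L²(ℝ) × H¹_*(0,L) × L²(0,L) × L²(ℝ)`, whose elements are the tuples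
`(V, f, φ₁, P, g, φ₂)`. -/
def State : Type :=
  H1Star p.L_pos × L2I p.L × L2R × H1Star p.L_pos × L2I p.L × L2R

noncomputable instance : AddCommGroup (State p) :=
  inferInstanceAs (AddCommGroup (H1Star p.L_pos × L2I p.L × L2R × H1Star p.L_pos × L2I p.L × L2R))

noncomputable instance : Module ℂ (State p) :=
  inferInstanceAs (Module ℂ (H1Star p.L_pos × L2I p.L × L2R × H1Star p.L_pos × L2I p.L × L2R))

namespace State

variable {p}

/-- The components of `U = (V, f, φ₁, P, g, φ₂)`. -/
noncomputable def V (U : State p) : H1 p.L := U.1.1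
noncomputable def f (U : State p) : L2I p.L := U.2.1
noncomputable def φ₁ (U : State p) : L2R := U.2.2.1
noncomputable def P (U : State p) : H1 p.L := U.2.2.2.1.1
noncomputable def g (U : State p) : L2I p.L := U.2.2.2.2.1
noncomputable def φ₂ (U : State p) : L2R := U.2.2.2.2.2

/-- `V_x` -/
noncomputable def Vx (U : State p) : L2I p.L := wderiv p.L U.V
/-- `P_x` -/
noncomputable def Px (U : State p) : L2I p.L := wderiv p.L U.P

theorem V_add (U W : State p) : (U + W).V = U.V + W.V := rfl
theorem f_add (U W : State p) : (U + W).f = U.f + W.f := rfl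
theorem φ₁_add (U W : State p) : (U + W).φ₁ = U.φ₁ + W.φ₁ := rfl
theorem P_add (U W : State p) : (U + W).P = U.P + W.P := rfl
theorem g_add (U W : State p) : (U + W).g = U.g + W.g := rfl
theorem φ₂_add (U W : State p) : (U + W).φ₂ = U.φ₂ + W.φ₂ := rfl
theorem V_smul (c : ℂ) (U : State p) : (c • U).V = c • U.V := rfl
theorem f_smul (c : ℂ) (U : State p) : (c • U).f = c • U.f := rfl
theorem φ₁_smul (c : ℂ) (U : State p) : (c • U).φ₁ = c • U.φ₁ := rfl
theorem P_smul (c : ℂ) (U : State p) : (c • U).P = c • U.P := rfl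
theorem g_smul (c : ℂ) (U : State p) : (c • U).g = c • U.g := rfl
theorem φ₂_smul (c : ℂ) (U : State p) : (c • U).φ₂ = c • U.φ₂ := rfl
theorem Vx_add (U W : State p) : (U + W).Vx = U.Vx + W.Vx := map_add _ _ _
theorem Px_add (U W : State p) : (U + W).Px = U.Px + W.Px := map_add _ _ _
theorem Vx_smul (c : ℂ) (U : State p) : (c • U).Vx = c • U.Vx := map_smul _ _ _
theorem Px_smul (c : ℂ) (U : State p) : (c • U).Px = c • U.Px := map_smul _ _ _
theorem Vx_zero : (0 : State p).Vx = 0 := map_zero _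
theorem Px_zero : (0 : State p).Px = 0 := map_zero _

theorem ext {U W : State p} (h1 : U.V = W.V) (h2 : U.f = W.f) (h3 : U.φ₁ = W.φ₁)
    (h4 : U.P = W.P) (h5 : U.g = W.g) (h6 : U.φ₂ = W.φ₂) : U = W :=
  Prod.ext (Subtype.ext h1) <| Prod.ext h2 <| Prod.ext h3 <|
    Prod.ext (Subtype.ext h4) <| Prod.ext h5 h6

/-- The inner product of the state space. As everywhere in Mathlib it is linear in the second
argument: `energyInner U W = ∫₀ᴸ (ρ f_W conj f_U + …) dx + …`. -/
noncomputable def energyInner (U W : State p) : ℂ :=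
  (∫ x in Ioo 0 p.L,
      ((p.ρ : ℂ) * (W.f x * star (U.f x)) + (p.μ : ℂ) * (W.g x * star (U.g x))
        + (p.α₁ : ℂ) * (W.Vx x * star (U.Vx x))
        + (p.β : ℂ) * (((p.γ : ℂ) * W.Vx x - W.Px x) * star ((p.γ : ℂ) * U.Vx x - U.Px x))))
    + (p.κ : ℂ) * ∫ ξ : ℝ,
      ((p.l₁ : ℂ) * (W.φ₁ ξ * star (U.φ₁ ξ)) + (p.l₂ : ℂ) * (W.φ₂ ξ * star (U.φ₂ ξ)))

theorem energyInner_eq (U W : State p) : energyInner U W =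
    p.ρ * inner ℂ U.f W.f + p.μ * inner ℂ U.g W.g + p.α₁ * inner ℂ U.Vx W.Vx
      + p.β * inner ℂ ((p.γ : ℂ) • U.Vx - U.Px) ((p.γ : ℂ) • W.Vx - W.Px)
      + p.κ * (p.l₁ * inner ℂ U.φ₁ W.φ₁ + p.l₂ * inner ℂ U.φ₂ W.φ₂) := by
  have e : ∀ {α : Type} [MeasurableSpace α] {ν : Measure α} (u w : Lp ℂ 2 ν),
      inner ℂ u w = ∫ x, w x * star (u x) ∂ν := fun u w => rfl
  have i : ∀ {α : Type} [MeasurableSpace α] {ν : Measure α} (u w : Lp ℂ 2 ν),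
      Integrable (fun x => w x * star (u x)) ν := fun u w => L2.integrable_inner u w
  have key : inner ℂ ((p.γ : ℂ) • U.Vx - U.Px) ((p.γ : ℂ) • W.Vx - W.Px)
      = ∫ x in Ioo 0 p.L,
        ((p.γ : ℂ) * W.Vx x - W.Px x) * star ((p.γ : ℂ) * U.Vx x - U.Px x) := by
    rw [e]
    apply integral_congr_ae
    filter_upwards [Lp.coeFn_sub ((p.γ : ℂ) • U.Vx) U.Px, Lp.coeFn_smul (p.γ : ℂ) U.Vx,
      Lp.coeFn_sub ((p.γ : ℂ) • W.Vx) W.Px, Lp.coeFn_smul (p.γ : ℂ) W.Vx] with x h1 h2 h3 h4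
    rw [h1, h3, Pi.sub_apply, Pi.sub_apply, h2, h4]; rfl
  have ikey : Integrable (fun x => ((p.γ : ℂ) * W.Vx x - W.Px x)
      * star ((p.γ : ℂ) * U.Vx x - U.Px x)) (volume.restrict (Ioo 0 p.L)) := by
    refine (i ((p.γ : ℂ) • U.Vx - U.Px) ((p.γ : ℂ) • W.Vx - W.Px)).congr ?_
    filter_upwards [Lp.coeFn_sub ((p.γ : ℂ) • U.Vx) U.Px, Lp.coeFn_smul (p.γ : ℂ) U.Vx,
      Lp.coeFn_sub ((p.γ : ℂ) • W.Vx) W.Px, Lp.coeFn_smul (p.γ : ℂ) W.Vx] with x h1 h2 h3 h4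
    rw [h1, h3, Pi.sub_apply, Pi.sub_apply, h2, h4]; rfl
  rw [energyInner, key, e, e, e, e, e]
  have j1 := (i U.f W.f).const_mul (p.ρ : ℂ)
  have j2 := (i U.g W.g).const_mul (p.μ : ℂ)
  have j3 := (i U.Vx W.Vx).const_mul (p.α₁ : ℂ)
  have j4 := ikey.const_mul (p.β : ℂ)
  have j5 := (i U.φ₁ W.φ₁).const_mul (p.l₁ : ℂ)
  have j6 := (i U.φ₂ W.φ₂).const_mul (p.l₂ : ℂ)
  have k1 := integral_add j1 j2
  have k2 := integral_add (j1.add j2) j3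
  have k3 := integral_add ((j1.add j2).add j3) j4
  have k4 := integral_add j5 j6
  simp only [Pi.add_apply, integral_const_mul] at k1 k2 k3 k4
  rw [k3, k2, k1, k4]

end State

theorem State.re_inner_self (U : State p) : (State.energyInner U U).re =
    p.ρ * ‖U.f‖ ^ 2 + p.μ * ‖U.g‖ ^ 2 + p.α₁ * ‖U.Vx‖ ^ 2
      + p.β * ‖(p.γ : ℂ) • U.Vx - U.Px‖ ^ 2
      + p.κ * (p.l₁ * ‖U.φ₁‖ ^ 2 + p.l₂ * ‖U.φ₂‖ ^ 2) := by
  rw [State.energyInner_eq]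
  simp only [inner_self_eq_norm_sq_to_K, Complex.add_re, Complex.re_ofReal_mul,
    Complex.coe_algebraMap, ← Complex.ofReal_pow, Complex.ofReal_re]

/-- The state space with its inner product is a pre-Hilbert space; in particular the form is
positive definite. -/
@[reducible] noncomputable def stateCore : InnerProductSpace.Core ℂ (State p) where
  inner := State.energyInner
  conj_inner_symm U W := by
    simp only [State.energyInner_eq, map_add, map_mul, Complex.conj_ofReal, inner_conj_symm]
  re_inner_nonneg U := by
    have h1 := p.ρ_pos; have h2 := p.μ_pos; have h3 := p.α₁_pos; have h4 := p.β_pos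
    have h5 := p.κ_pos; have h6 := p.l₁_pos; have h7 := p.l₂_pos
    change 0 ≤ (State.energyInner U U).re
    rw [State.re_inner_self]
    positivity
  add_left U U' W := by
    simp only [State.energyInner_eq, State.f_add, State.g_add, State.Vx_add, State.Px_add,
      State.φ₁_add, State.φ₂_add, inner_add_left, smul_add, add_sub_add_comm]
    ring
  smul_left U W c := by
    have : (p.γ : ℂ) • c • U.Vx - c • U.Px = c • ((p.γ : ℂ) • U.Vx - U.Px) := by
      rw [smul_sub, smul_comm]
    simp only [State.energyInner_eq, State.f_smul, State.g_smul, State.Vx_smul, State.Px_smul,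
      State.φ₁_smul, State.φ₂_smul, this, inner_smul_left]
    ring
  definite U h := by
    have h1 := p.ρ_pos; have h2 := p.μ_pos; have h3 := p.α₁_pos; have h4 := p.β_pos
    have h5 := p.κ_pos; have h6 := p.l₁_pos; have h7 := p.l₂_pos
    have h0 : (State.energyInner U U).re = 0 := by
      have h' : State.energyInner U U = 0 := h
      rw [h']; rfl
    rw [State.re_inner_self] at h0
    have n1 : 0 ≤ p.ρ * ‖U.f‖ ^ 2 := by positivity
    have n2 : 0 ≤ p.μ * ‖U.g‖ ^ 2 := by positivity
    have n3 : 0 ≤ p.α₁ * ‖U.Vx‖ ^ 2 := by positivity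
    have n4 : 0 ≤ p.β * ‖(p.γ : ℂ) • U.Vx - U.Px‖ ^ 2 := by positivity
    have n5 : 0 ≤ p.κ * (p.l₁ * ‖U.φ₁‖ ^ 2) := by positivity
    have n6 : 0 ≤ p.κ * (p.l₂ * ‖U.φ₂‖ ^ 2) := by positivity
    rw [mul_add] at h0
    have z1 : p.ρ * ‖U.f‖ ^ 2 = 0 := by linarith
    have z2 : p.μ * ‖U.g‖ ^ 2 = 0 := by linarith
    have z3 : p.α₁ * ‖U.Vx‖ ^ 2 = 0 := by linarith
    have z4 : p.β * ‖(p.γ : ℂ) • U.Vx - U.Px‖ ^ 2 = 0 := by linarith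
    have z5 : p.κ * (p.l₁ * ‖U.φ₁‖ ^ 2) = 0 := by linarith
    have z6 : p.κ * (p.l₂ * ‖U.φ₂‖ ^ 2) = 0 := by linarith
    simp only [mul_eq_zero, h1.ne', h2.ne', h3.ne', h4.ne', h5.ne', h6.ne', h7.ne', false_or,
      pow_eq_zero_iff two_ne_zero, norm_eq_zero] at z1 z2 z3 z4 z5 z6
    rw [z3, smul_zero, zero_sub, neg_eq_zero] at z4
    exact State.ext (eq_zero_of_wderiv_eq_zero p.L_pos _ z3 U.1.2) z1 z5
      (eq_zero_of_wderiv_eq_zero p.L_pos _ z4 U.2.2.2.1.2) z2 z6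

noncomputable instance : NormedAddCommGroup (State p) :=
  (stateCore p).toNormedAddCommGroup

noncomputable instance : InnerProductSpace ℂ (State p) :=
  InnerProductSpace.ofCore (stateCore p).toCore

theorem State.inner_eq (U W : State p) : inner ℂ U W = State.energyInner U W := rfl

/-- `-(ξ² + η) φ(ξ) + c μ(ξ)` as a function of `ξ`. -/
noncomputable def diffusion (c : ℂ) (φ : L2R) (ξ : ℝ) : ℂ :=
  -((ξ ^ 2 + p.η : ℝ) : ℂ) * φ ξ + c * (p.kern ξ : ℂ)

theorem diffusion_add (c c' : ℂ) (φ φ' : L2R) :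
    diffusion p (c + c') (φ + φ') =ᵐ[volume] diffusion p c φ + diffusion p c' φ' := by
  filter_upwards [Lp.coeFn_add φ φ'] with ξ h
  simp only [diffusion, h, Pi.add_apply]; ring

theorem diffusion_smul (r c : ℂ) (φ : L2R) :
    diffusion p (r * c) (r • φ) =ᵐ[volume] r • diffusion p c φ := by
  filter_upwards [Lp.coeFn_smul r φ] with ξ h
  simp only [diffusion, h, Pi.smul_apply, smul_eq_mul]; ring

theorem memLp_kern : MemLp (fun ξ : ℝ => p.kern ξ / (1 + |ξ|)) 2 volume := by
  have ha := p.a_pos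
  have ha' := p.a_lt_one
  have hmeas : Measurable (fun ξ : ℝ => p.kern ξ / (1 + |ξ|)) := by
    unfold Params.kern; fun_prop
  rw [memLp_two_iff_integrable_sq hmeas.aestronglyMeasurable]
  let k : ℝ → ℝ := (Ioi 0).indicator fun ξ => (p.kern ξ / (1 + |ξ|)) ^ 2
  have hsq : ∀ ξ : ℝ, 0 < ξ → (p.kern ξ) ^ 2 = ξ ^ (2 * p.a - 1) := by
    intro ξ hξ
    rw [Params.kern, abs_of_pos hξ, ← Real.rpow_natCast, ← Real.rpow_mul hξ.le]
    congr 1; push_cast; ring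
  have hk : Integrable k := by
    rw [integrable_indicator_iff measurableSet_Ioi, ← Ioc_union_Ioi_eq_Ioi zero_le_one]
    refine IntegrableOn.union ?_ ?_
    · have h := (intervalIntegral.intervalIntegrable_rpow' (a := 0) (b := 1)
        (by linarith : -1 < 2 * p.a - 1)).1
      refine h.mono' (hmeas.pow_const 2).aestronglyMeasurable ?_
      filter_upwards [ae_restrict_mem measurableSet_Ioc] with ξ hξ
      rw [Real.norm_of_nonneg (by positivity), div_pow, hsq ξ hξ.1]
      apply div_le_self (Real.rpow_nonneg hξ.1.le _)
      rw [abs_of_pos hξ.1]; nlinarith [hξ.1]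
    · have h := integrableOn_Ioi_rpow_of_lt (by linarith : 2 * p.a - 3 < -1) one_pos
      refine h.mono' (hmeas.pow_const 2).aestronglyMeasurable ?_
      filter_upwards [ae_restrict_mem measurableSet_Ioi] with ξ hξ
      have hξ0 : (0 : ℝ) < ξ := one_pos.trans hξ
      rw [Real.norm_of_nonneg (by positivity), div_pow, hsq ξ hξ0, abs_of_pos hξ0,
        show (2 * p.a - 3 : ℝ) = (2 * p.a - 1) - (2 : ℕ) by push_cast; ring,
        Real.rpow_sub_natCast hξ0.ne']
      apply div_le_div_of_nonneg_left (Real.rpow_nonneg hξ0.le _) (by positivity)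
      nlinarith
  refine (hk.add hk.comp_neg).congr ?_
  have h0 : ∀ᵐ ξ : ℝ, ξ ≠ 0 := by simp [ae_iff]
  filter_upwards [h0] with ξ hξ
  rcases lt_or_gt_of_ne hξ with h | h
  · have h1 : ξ ∉ Ioi (0 : ℝ) := fun h' => lt_asymm h h'
    have h2 : -ξ ∈ Ioi (0 : ℝ) := neg_pos.2 h
    simp [k, h1, h2, Params.kern]
  · have h1 : ξ ∈ Ioi (0 : ℝ) := h
    have h2 : -ξ ∉ Ioi (0 : ℝ) := fun h' => lt_asymm h (neg_pos.1 h')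
    simp [k, h1, h2, Params.kern]

/-- If `φ` and `|ξ| φ` are square integrable then `∫ μ(ξ) φ(ξ) dξ` converges. -/
theorem integrable_kern_mul {φ : L2R} (h : MemLp (fun ξ : ℝ => ((|ξ| : ℝ) : ℂ) * φ ξ) 2 volume) :
    Integrable (fun ξ : ℝ => (p.kern ξ : ℂ) * φ ξ) := by
  have h1 : MemLp (fun ξ : ℝ => φ ξ + ((|ξ| : ℝ) : ℂ) * φ ξ) 2 volume := (Lp.memLp φ).add h
  have h2 : MemLp (fun ξ : ℝ => ((p.kern ξ / (1 + |ξ|) : ℝ) : ℂ)) 2 volume :=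
    (memLp_kern p).ofReal
  refine (h2.integrable_mul h1).congr (Eventually.of_forall fun ξ => ?_)
  have h3 : (1 + ((|ξ| : ℝ) : ℂ)) ≠ 0 := by
    have : (0 : ℝ) < 1 + |ξ| := by positivity
    exact_mod_cast this.ne'
  simp only [Pi.mul_apply]
  push_cast
  field_simp

/-- The boundary value at `x = L`. -/
noncomputable def evalL : H1 p.L →ₗ[ℂ] ℂ := evalAt p.L_pos ⟨p.L, p.L_pos.le, le_rfl⟩

/-- The boundary value at `x = 0`. -/
noncomputable def evalZero : H1 p.L →ₗ[ℂ] ℂ := evalAt p.L_pos ⟨0, le_rfl, p.L_pos.le⟩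

/-- Membership of `U = (V, f, φ₁, P, g, φ₂)` in the domain of the operator: `V, P ∈ H²(0,L)`,
`f, g ∈ H¹_*(0,L)`, the conditions on `φ₁, φ₂`, and the two boundary conditions at `x = L`. -/
structure MemDomain (U : State p) : Prop where
  Vx_mem : U.Vx ∈ H1 p.L
  Px_mem : U.Px ∈ H1 p.L
  f_mem : U.f ∈ H1 p.L
  f_zero : evalZero p ⟨U.f, f_mem⟩ = 0
  g_mem : U.g ∈ H1 p.L
  g_zero : evalZero p ⟨U.g, g_mem⟩ = 0
  φ₁_mem : MemLp (fun ξ : ℝ => ((|ξ| : ℝ) : ℂ) * U.φ₁ ξ) 2 volume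
  φ₂_mem : MemLp (fun ξ : ℝ => ((|ξ| : ℝ) : ℂ) * U.φ₂ ξ) 2 volume
  diff₁_mem : MemLp (diffusion p (evalL p ⟨U.f, f_mem⟩) U.φ₁) 2 volume
  diff₂_mem : MemLp (diffusion p (evalL p ⟨U.g, g_mem⟩) U.φ₂) 2 volume
  bc₁ : (p.α : ℂ) * evalL p ⟨U.Vx, Vx_mem⟩ - (p.γ * p.β : ℂ) * evalL p ⟨U.Px, Px_mem⟩
    = -(p.l₁ * p.κ : ℂ) * ∫ ξ : ℝ, (p.kern ξ : ℂ) * U.φ₁ ξ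
  bc₂ : (p.β : ℂ) * evalL p ⟨U.Px, Px_mem⟩ - (p.γ * p.β : ℂ) * evalL p ⟨U.Vx, Vx_mem⟩
    = -(p.l₂ * p.κ : ℂ) * ∫ ξ : ℝ, (p.kern ξ : ℂ) * U.φ₂ ξ

theorem memLp_abs_add {φ φ' : L2R} (h : MemLp (fun ξ : ℝ => ((|ξ| : ℝ) : ℂ) * φ ξ) 2 volume)
    (h' : MemLp (fun ξ : ℝ => ((|ξ| : ℝ) : ℂ) * φ' ξ) 2 volume) :
    MemLp (fun ξ : ℝ => ((|ξ| : ℝ) : ℂ) * (φ + φ') ξ) 2 volume := by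
  refine (memLp_congr_ae ?_).1 (h.add h')
  filter_upwards [Lp.coeFn_add φ φ'] with ξ hξ
  simp only [hξ, Pi.add_apply]; ring

theorem memLp_abs_smul (c : ℂ) {φ : L2R} (h : MemLp (fun ξ : ℝ => ((|ξ| : ℝ) : ℂ) * φ ξ) 2 volume) :
    MemLp (fun ξ : ℝ => ((|ξ| : ℝ) : ℂ) * (c • φ) ξ) 2 volume := by
  refine (memLp_congr_ae ?_).1 (h.const_smul c)
  filter_upwards [Lp.coeFn_smul c φ] with ξ hξ
  simp only [hξ, Pi.smul_apply, smul_eq_mul]; ring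

theorem integral_kern_add {φ φ' : L2R} (h : MemLp (fun ξ : ℝ => ((|ξ| : ℝ) : ℂ) * φ ξ) 2 volume)
    (h' : MemLp (fun ξ : ℝ => ((|ξ| : ℝ) : ℂ) * φ' ξ) 2 volume) :
    ∫ ξ : ℝ, (p.kern ξ : ℂ) * (φ + φ') ξ
      = (∫ ξ : ℝ, (p.kern ξ : ℂ) * φ ξ) + ∫ ξ : ℝ, (p.kern ξ : ℂ) * φ' ξ := by
  rw [← integral_add (integrable_kern_mul p h) (integrable_kern_mul p h')]
  apply integral_congr_ae
  filter_upwards [Lp.coeFn_add φ φ'] with ξ hξ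
  simp only [hξ, Pi.add_apply]; ring

theorem integral_kern_smul (c : ℂ) (φ : L2R) :
    ∫ ξ : ℝ, (p.kern ξ : ℂ) * (c • φ) ξ = c * ∫ ξ : ℝ, (p.kern ξ : ℂ) * φ ξ := by
  rw [← integral_const_mul]
  apply integral_congr_ae
  filter_upwards [Lp.coeFn_smul c φ] with ξ hξ
  simp only [hξ, Pi.smul_apply, smul_eq_mul]; ring

theorem map_mk_add {F : Type*} [AddCommGroup F] [Module ℂ F] {L : ℝ} (T : H1 L →ₗ[ℂ] F)
    {u v w : L2I L} (hu : u ∈ H1 L) (hv : v ∈ H1 L) (hw : w ∈ H1 L) (h : w = u + v) :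
    T ⟨w, hw⟩ = T ⟨u, hu⟩ + T ⟨v, hv⟩ := by
  subst h; exact map_add T ⟨u, hu⟩ ⟨v, hv⟩

theorem map_mk_smul {F : Type*} [AddCommGroup F] [Module ℂ F] {L : ℝ} (T : H1 L →ₗ[ℂ] F)
    (c : ℂ) {u w : L2I L} (hu : u ∈ H1 L) (hw : w ∈ H1 L) (h : w = c • u) :
    T ⟨w, hw⟩ = c • T ⟨u, hu⟩ := by
  subst h; exact map_smul T c ⟨u, hu⟩

variable {p} in
theorem MemDomain.add {U W : State p} (h : MemDomain p U) (k : MemDomain p W) :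
    MemDomain p (U + W) := by
  have hV : (U + W).Vx ∈ H1 p.L := by
    rw [State.Vx_add]; exact add_mem h.Vx_mem k.Vx_mem
  have hP : (U + W).Px ∈ H1 p.L := by
    rw [State.Px_add]; exact add_mem h.Px_mem k.Px_mem
  have hf : (U + W).f ∈ H1 p.L := add_mem h.f_mem k.f_mem
  have hg : (U + W).g ∈ H1 p.L := add_mem h.g_mem k.g_mem
  have eV := map_mk_add (evalL p) h.Vx_mem k.Vx_mem hV (State.Vx_add U W)
  have eP := map_mk_add (evalL p) h.Px_mem k.Px_mem hP (State.Px_add U W)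
  refine ⟨hV, hP, hf, ?_, hg, ?_, memLp_abs_add h.φ₁_mem k.φ₁_mem,
    memLp_abs_add h.φ₂_mem k.φ₂_mem, ?_, ?_, ?_, ?_⟩
  · rw [map_mk_add (evalZero p) h.f_mem k.f_mem hf (State.f_add U W), h.f_zero, k.f_zero, add_zero]
  · rw [map_mk_add (evalZero p) h.g_mem k.g_mem hg (State.g_add U W), h.g_zero, k.g_zero, add_zero]
  · rw [map_mk_add (evalL p) h.f_mem k.f_mem hf (State.f_add U W), State.φ₁_add]
    exact (memLp_congr_ae (diffusion_add p _ _ _ _)).2 (h.diff₁_mem.add k.diff₁_mem)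
  · rw [map_mk_add (evalL p) h.g_mem k.g_mem hg (State.g_add U W), State.φ₂_add]
    exact (memLp_congr_ae (diffusion_add p _ _ _ _)).2 (h.diff₂_mem.add k.diff₂_mem)
  · rw [eV, eP, State.φ₁_add, integral_kern_add p h.φ₁_mem k.φ₁_mem]
    linear_combination h.bc₁ + k.bc₁
  · rw [eV, eP, State.φ₂_add, integral_kern_add p h.φ₂_mem k.φ₂_mem]
    linear_combination h.bc₂ + k.bc₂

variable {p} in
theorem MemDomain.smul (c : ℂ) {U : State p} (h : MemDomain p U) : MemDomain p (c • U) := by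
  have hV : (c • U).Vx ∈ H1 p.L := by
    rw [State.Vx_smul]; exact (H1 p.L).smul_mem c h.Vx_mem
  have hP : (c • U).Px ∈ H1 p.L := by
    rw [State.Px_smul]; exact (H1 p.L).smul_mem c h.Px_mem
  have hf : (c • U).f ∈ H1 p.L := (H1 p.L).smul_mem c h.f_mem
  have hg : (c • U).g ∈ H1 p.L := (H1 p.L).smul_mem c h.g_mem
  have eV := map_mk_smul (evalL p) c h.Vx_mem hV (State.Vx_smul c U)
  have eP := map_mk_smul (evalL p) c h.Px_mem hP (State.Px_smul c U)
  refine ⟨hV, hP, hf, ?_, hg, ?_, memLp_abs_smul c h.φ₁_mem,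
    memLp_abs_smul c h.φ₂_mem, ?_, ?_, ?_, ?_⟩
  · rw [map_mk_smul (evalZero p) c h.f_mem hf (State.f_smul c U), h.f_zero, smul_zero]
  · rw [map_mk_smul (evalZero p) c h.g_mem hg (State.g_smul c U), h.g_zero, smul_zero]
  · rw [map_mk_smul (evalL p) c h.f_mem hf (State.f_smul c U), State.φ₁_smul]
    exact (memLp_congr_ae (diffusion_smul p _ _ _)).2 (h.diff₁_mem.const_smul c)
  · rw [map_mk_smul (evalL p) c h.g_mem hg (State.g_smul c U), State.φ₂_smul]
    exact (memLp_congr_ae (diffusion_smul p _ _ _)).2 (h.diff₂_mem.const_smul c)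
  · rw [eV, eP, State.φ₁_smul, integral_kern_smul, mul_left_comm, ← h.bc₁, smul_eq_mul,
      smul_eq_mul]
    ring
  · rw [eV, eP, State.φ₂_smul, integral_kern_smul, mul_left_comm, ← h.bc₂, smul_eq_mul,
      smul_eq_mul]
    ring

theorem MemDomain.zero : MemDomain p 0 := by
  have hV : (0 : State p).Vx ∈ H1 p.L := by rw [State.Vx_zero]; exact zero_mem _
  have hP : (0 : State p).Px ∈ H1 p.L := by rw [State.Px_zero]; exact zero_mem _
  have z : ∀ h : (0 : L2I p.L) ∈ H1 p.L, ∀ T : H1 p.L →ₗ[ℂ] ℂ, T ⟨0, h⟩ = 0 :=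
    fun _ T => map_zero T
  have eV : evalL p ⟨(0 : State p).Vx, hV⟩ = 0 := by
    have : (⟨(0 : State p).Vx, hV⟩ : H1 p.L) = 0 := Subtype.ext State.Vx_zero
    rw [this, map_zero]
  have eP : evalL p ⟨(0 : State p).Px, hP⟩ = 0 := by
    have : (⟨(0 : State p).Px, hP⟩ : H1 p.L) = 0 := Subtype.ext State.Px_zero
    rw [this, map_zero]
  have h0 : ∀ m : ℝ → ℂ, (fun ξ : ℝ => m ξ * (0 : L2R) ξ) =ᵐ[volume] 0 := by
    intro m
    filter_upwards [Lp.coeFn_zero ℂ 2 (volume : Measure ℝ)] with ξ hξ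
    rw [hξ]; simp
  have hm : MemLp (fun ξ : ℝ => ((|ξ| : ℝ) : ℂ) * (0 : L2R) ξ) 2 volume :=
    (memLp_congr_ae (h0 _)).2 MemLp.zero
  have hd : MemLp (diffusion p 0 0) 2 volume := by
    refine (memLp_congr_ae ?_).2 (MemLp.zero : MemLp (0 : ℝ → ℂ) 2 volume)
    filter_upwards [h0 fun ξ => -((ξ ^ 2 + p.η : ℝ) : ℂ)] with ξ hξ
    rw [diffusion, hξ]; simp
  have hi : ∫ ξ : ℝ, (p.kern ξ : ℂ) * (0 : L2R) ξ = 0 := integral_eq_zero_of_ae (h0 _)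
  refine ⟨hV, hP, zero_mem (H1 p.L), z _ _, zero_mem (H1 p.L), z _ _, hm, hm, ?_, ?_, ?_, ?_⟩
  · have := z (zero_mem _) (evalL p)
    change MemLp (diffusion p (evalL p ⟨(0 : L2I p.L), _⟩) 0) 2 volume
    rw [this]; exact hd
  · have := z (zero_mem _) (evalL p)
    change MemLp (diffusion p (evalL p ⟨(0 : L2I p.L), _⟩) 0) 2 volume
    rw [this]; exact hd
  · change _ = _ * ∫ ξ : ℝ, (p.kern ξ : ℂ) * (0 : L2R) ξ
    rw [eV, eP, hi]; ring
  · change _ = _ * ∫ ξ : ℝ, (p.kern ξ : ℂ) * (0 : L2R) ξ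
    rw [eV, eP, hi]; ring

/-- The domain of the operator. -/
noncomputable def domain : Submodule ℂ (State p) where
  carrier := {U | MemDomain p U}
  add_mem' h k := h.add k
  zero_mem' := MemDomain.zero p
  smul_mem' c _ h := h.smul c

variable {p} in
/-- The image `(f, (α V_xx - γβ P_xx)/ρ, -(ξ²+η)φ₁ + f(L)μ, g, (-γβ V_xx + β P_xx)/μ,
-(ξ²+η)φ₂ + g(L)μ)` of an element of the domain. -/
noncomputable def opFun (U : State p) (h : MemDomain p U) : State p :=
  (⟨⟨U.f, h.f_mem⟩, h.f_zero⟩,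
    ((p.α / p.ρ : ℝ) : ℂ) • wderiv p.L ⟨U.Vx, h.Vx_mem⟩
      - ((p.γ * p.β / p.ρ : ℝ) : ℂ) • wderiv p.L ⟨U.Px, h.Px_mem⟩,
    h.diff₁_mem.toLp _,
    ⟨⟨U.g, h.g_mem⟩, h.g_zero⟩,
    -((p.γ * p.β / p.μ : ℝ) : ℂ) • wderiv p.L ⟨U.Vx, h.Vx_mem⟩
      + ((p.β / p.μ : ℝ) : ℂ) • wderiv p.L ⟨U.Px, h.Px_mem⟩,
    h.diff₂_mem.toLp _)

variable {p} in
theorem opFun_add {U W : State p} (h : MemDomain p U) (k : MemDomain p W) :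
    opFun (U + W) (h.add k) = opFun U h + opFun W k := by
  have hUW := h.add k
  have eV := map_mk_add (wderiv p.L) h.Vx_mem k.Vx_mem hUW.Vx_mem (State.Vx_add U W)
  have eP := map_mk_add (wderiv p.L) h.Px_mem k.Px_mem hUW.Px_mem (State.Px_add U W)
  refine State.ext ?_ ?_ ?_ ?_ ?_ ?_
  · rw [State.V_add]; exact Subtype.ext (State.f_add U W)
  · rw [State.f_add]; simp only [State.f, opFun]
    rw [eV, eP, smul_add, smul_add]; abel
  · rw [State.φ₁_add]; simp only [State.φ₁, opFun]
    rw [← MemLp.toLp_add, MemLp.toLp_eq_toLp_iff,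
      map_mk_add (evalL p) h.f_mem k.f_mem hUW.f_mem (State.f_add U W)]
    exact diffusion_add p _ _ _ _
  · rw [State.P_add]; exact Subtype.ext (State.g_add U W)
  · rw [State.g_add]; simp only [State.g, opFun]
    rw [eV, eP, smul_add, smul_add]; abel
  · rw [State.φ₂_add]; simp only [State.φ₂, opFun]
    rw [← MemLp.toLp_add, MemLp.toLp_eq_toLp_iff,
      map_mk_add (evalL p) h.g_mem k.g_mem hUW.g_mem (State.g_add U W)]
    exact diffusion_add p _ _ _ _

variable {p} in
theorem opFun_smul (c : ℂ) {U : State p} (h : MemDomain p U) :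
    opFun (c • U) (h.smul c) = c • opFun U h := by
  have hc := h.smul c
  have eV := map_mk_smul (wderiv p.L) c h.Vx_mem hc.Vx_mem (State.Vx_smul c U)
  have eP := map_mk_smul (wderiv p.L) c h.Px_mem hc.Px_mem (State.Px_smul c U)
  refine State.ext ?_ ?_ ?_ ?_ ?_ ?_
  · rw [State.V_smul]; exact Subtype.ext (State.f_smul c U)
  · rw [State.f_smul]; simp only [State.f, opFun]
    rw [eV, eP, smul_sub, smul_comm _ c, smul_comm _ c]
  · rw [State.φ₁_smul]; simp only [State.φ₁, opFun]
    rw [← MemLp.toLp_const_smul, MemLp.toLp_eq_toLp_iff,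
      map_mk_smul (evalL p) c h.f_mem hc.f_mem (State.f_smul c U)]
    exact diffusion_smul p _ _ _
  · rw [State.P_smul]; exact Subtype.ext (State.g_smul c U)
  · rw [State.g_smul]; simp only [State.g, opFun]
    rw [eV, eP, smul_add, smul_comm _ c, smul_comm _ c]
  · rw [State.φ₂_smul]; simp only [State.φ₂, opFun]
    rw [← MemLp.toLp_const_smul, MemLp.toLp_eq_toLp_iff,
      map_mk_smul (evalL p) c h.g_mem hc.g_mem (State.g_smul c U)]
    exact diffusion_smul p _ _ _

/-- The operator `𝒜` of the augmented beam system, an unbounded operator on the state space. -/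
noncomputable def beamOp : State p →ₗ.[ℂ] State p where
  domain := domain p
  toFun :=
    { toFun := fun U => opFun U.1 U.2
      map_add' := fun U W => opFun_add U.2 W.2
      map_smul' := fun c U => opFun_smul c U.2 }

end PiezoBeam

section Evolution

variable {E : Type*} [NormedAddCommGroup E] [NormedSpace ℂ E]

/-- `(S t)`, `t ≥ 0`, is a `C₀`-semigroup of contractions; the values at `t < 0` are irrelevant. -/
structure IsContractionSemigroup (S : ℝ → E →L[ℂ] E) : Prop where
  zero : S 0 = ContinuousLinearMap.id ℂ E
  add : ∀ s t, 0 ≤ s → 0 ≤ t → S (s + t) = (S s).comp (S t)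
  strong_cont : ∀ x, Tendsto (fun t => S t x) (𝓝[>] 0) (𝓝 x)
  contraction : ∀ t, 0 ≤ t → ‖S t‖ ≤ 1

/-- `A` is the infinitesimal generator of `S`: its domain is the set of `x` for which the limit of
`(S t x - x) / t` as `t ↓ 0` exists, and `A x` is that limit. -/
def IsGenerator (A : E →ₗ.[ℂ] E) (S : ℝ → E →L[ℂ] E) : Prop :=
  ∀ x y : E, (x, y) ∈ A.graph ↔ Tendsto (fun t : ℝ => t⁻¹ • (S t x - x)) (𝓝[>] 0) (𝓝 y)

/-- `U` solves `U_t = A U` on `[0,∞)`, `U(0) = U₀`. -/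
structure IsSolution (A : E →ₗ.[ℂ] E) (U₀ : E) (U : ℝ → E) : Prop where
  initial : U 0 = U₀
  equation : ∀ t, 0 ≤ t → ∃ W : E, (U t, W) ∈ A.graph ∧ HasDerivWithinAt U W (Ici 0) t

/-- `U ∈ C([0,∞); D(A))`, where `D(A)` carries the graph norm. -/
def IsContinuousInDomain (A : E →ₗ.[ℂ] E) (U : ℝ → E) : Prop :=
  ∃ W : ℝ → E, (∀ t, 0 ≤ t → (U t, W t) ∈ A.graph) ∧
    ContinuousOn U (Ici 0) ∧ ContinuousOn W (Ici 0)

end Evolution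

/-! The operator is dissipative and maps its domain onto the whole space, and on a Hilbert space
these two facts suffice for generation and for well-posedness of the Cauchy problem. Surjectivity is
used at the spectral point 0, not at some λ > 0, so the argument runs on the inverse G.

Abstract part. A dissipative surjection A is injective. Its inverse G is dissipative and defined
everywhere, hence bounded by the closed graph theorem (`continuous_of_re_inner_nonpos`). Being
injective, it also has dense range (`denseRange_of_injective_of_re_inner_nonpos`), so D(A) is dense.
For ε > 0 the operator G - ε is coercive up to sign, and its inverse is the bounded dissipative
Yosida approximation of A. The exponentials of these approximations are commuting contractions, and
they converge strongly to a semigroup S. The limit of their integrated equations is S(t)Gx = Gx +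
∫₀ᵗ S(s)x ds. This identity, with the commutation of S and G, yields the generator, the regularity
of orbits and the solution property. Uniqueness follows because the norm of the difference of two
solutions cannot grow.

Beam part. The state space is complete because the energy norm is a weighted L² norm of (f, g, V_x,
γV_x - P_x, φ₁, φ₂). Dissipativity (`re_inner_opFun_nonpos`) uses the stresses σ = αV_x - γβP_x and
τ = βP_x - γβV_x. Integration by parts leaves only boundary terms at L, which the boundary
conditions express through ∫ μφᵢ, and these cancel the coupling terms of the diffusion equations.
What remains is at most -κ ∑ lᵢ ∫ (ξ² + η)|φᵢ|². Surjectivity (`exists_opFun_eq`) is explicit: 𝒜U =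
F prescribes f and g, hence f(L) and g(L). The φᵢ then follow by division by ξ² + η, σ and τ by
integration from L, and V and P by integration from 0. -/

section Dissipative

/-! ### Dissipative operators and their exponentials. -/

variable {E : Type*} [NormedAddCommGroup E] [InnerProductSpace ℂ E]

/-- If `Re ⟨u, u'⟩ ≤ 0` on `[0,∞)` then `‖u‖` does not exceed its initial value. -/
theorem norm_le_norm_zero_of_re_inner_nonpos {u u' : ℝ → E}
    (hu : ∀ t, 0 ≤ t → HasDerivWithinAt u (u' t) (Ici 0) t)
    (h : ∀ t, 0 ≤ t → (inner ℂ (u t) (u' t)).re ≤ 0) {t : ℝ} (ht : 0 ≤ t) : ‖u t‖ ≤ ‖u 0‖ := by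
  have hd : ∀ t, 0 ≤ t → HasDerivWithinAt (fun s => ‖u s‖ ^ 2)
      (2 * (inner ℂ (u t) (u' t)).re) (Ici 0) t := by
    intro t ht
    have h1 := (hu t ht).inner ℂ (hu t ht)
    have h2 := Complex.reCLM.hasFDerivAt.comp_hasDerivWithinAt t h1
    refine (h2.congr_deriv ?_).congr_of_mem (fun s _ => ?_) ht
    · rw [Complex.reCLM_apply, Complex.add_re, ← inner_conj_symm (u' t), Complex.conj_re]; ring
    · exact (inner_self_eq_norm_sq (𝕜 := ℂ) (u s)).symm
  have hanti : AntitoneOn (fun s => ‖u s‖ ^ 2) (Ici 0) := by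
    refine antitoneOn_of_deriv_nonpos (convex_Ici 0) (fun s hs => (hd s hs).continuousWithinAt)
      ?_ ?_
    · intro s hs
      exact ((hd s (interior_subset hs)).mono interior_subset).differentiableWithinAt
    · intro s hs
      rw [((hd s (interior_subset hs)).hasDerivAt (mem_interior_iff_mem_nhds.1 hs)).deriv]
      linarith [h s (interior_subset hs)]
  exact (sq_le_sq₀ (norm_nonneg _) (norm_nonneg _)).1
    (hanti (mem_Ici.2 le_rfl) (mem_Ici.2 ht) ht)

/-- The real quadratic form Re ⟨x, Ax⟩ attains its maximum 0 at y, so its first variation there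
vanishes in every direction x. -/
theorem re_inner_add_re_inner_eq_zero {A : E →ₗ[ℂ] E} (hA : ∀ x, (inner ℂ x (A x)).re ≤ 0)
    {y : E} (hy : (inner ℂ y (A y)).re = 0) (x : E) :
    (inner ℂ x (A y)).re + (inner ℂ y (A x)).re = 0 := by
  have key : ∀ t : ℝ, t * ((inner ℂ x (A y)).re + (inner ℂ y (A x)).re)
      + t ^ 2 * (inner ℂ x (A x)).re ≤ 0 := by
    intro t
    have := hA (y + (t : ℂ) • x)
    simp only [map_add, map_smul, inner_add_left, inner_add_right, inner_smul_left,
      inner_smul_right, Complex.conj_ofReal, Complex.add_re, Complex.re_ofReal_mul, hy] at this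
    linarith
  set b := (inner ℂ x (A y)).re + (inner ℂ y (A x)).re
  set c := (inner ℂ x (A x)).re
  have hc : c ≤ 0 := hA x
  -- With t = b / (1 - c) the quadratic equals b² / (1 - c)², and the denominator is positive even
  -- when c = 0.
  have h1 := key (b / (1 - c))
  have hc' : 0 < 1 - c := by linarith
  have h2 : b / (1 - c) * b + (b / (1 - c)) ^ 2 * c = b ^ 2 / (1 - c) ^ 2 := by
    field_simp; ring
  rw [h2] at h1
  have h3 : 0 < (1 - c) ^ 2 := by positivity
  have h4 : b ^ 2 ≤ 0 := by
    by_contra h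
    exact absurd h1 (not_le.2 (div_pos (not_le.1 h) h3))
  exact pow_eq_zero_iff two_ne_zero |>.1 (le_antisymm h4 (sq_nonneg _))

variable [CompleteSpace E]

/-- A dissipative linear map defined everywhere on a Hilbert space is bounded. -/
theorem continuous_of_re_inner_nonpos {A : E →ₗ[ℂ] E} (hA : ∀ x, (inner ℂ x (A x)).re ≤ 0) :
    Continuous A := by
  refine A.continuous_of_seq_closed_graph fun u x y hu hAu => ?_
  -- Minty's trick: test dissipativity at uₙ - x + tw, pass to the limit in n, and divide by t.
  -- Letting t ↓ 0 and then taking w = y - Ax forces y = Ax.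
  have key : ∀ w : E, ∀ t : ℝ, 0 < t →
      (inner ℂ w (y - A x)).re + t * (inner ℂ w (A w)).re ≤ 0 := by
    intro w t ht
    have h1 : Tendsto (fun n => (inner ℂ (u n - x + (t : ℂ) • w)
        (A (u n) - A x + (t : ℂ) • A w)).re) atTop
        (𝓝 (inner ℂ (x - x + (t : ℂ) • w) (y - A x + (t : ℂ) • A w)).re) := by
      refine (Complex.continuous_re.tendsto _).comp (Tendsto.inner ?_ ?_)
      · exact (hu.sub tendsto_const_nhds).add tendsto_const_nhds
      · exact (hAu.sub tendsto_const_nhds).add tendsto_const_nhds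
    have h2 := le_of_tendsto' h1 (b := 0) fun n => by
      have := hA (u n - x + (t : ℂ) • w)
      rwa [map_add, map_sub, map_smul] at this
    rw [sub_self, zero_add, inner_smul_left, inner_add_right, inner_smul_right,
      Complex.conj_ofReal, Complex.re_ofReal_mul, Complex.add_re, Complex.re_ofReal_mul] at h2
    exact nonpos_of_mul_nonpos_right h2 ht
  have h0 : ∀ w : E, (inner ℂ w (y - A x)).re ≤ 0 := by
    intro w
    have h1 : Tendsto (fun t : ℝ => (inner ℂ w (y - A x)).re + t * (inner ℂ w (A w)).re)
        (𝓝[>] 0) (𝓝 ((inner ℂ w (y - A x)).re + 0 * (inner ℂ w (A w)).re)) :=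
      tendsto_const_nhds.add ((tendsto_id.mono_left nhdsWithin_le_nhds).mul_const _)
    rw [zero_mul, add_zero] at h1
    exact le_of_tendsto h1 (eventually_mem_nhdsWithin.mono fun t ht => key w t ht)
  have h1 := h0 (y - A x)
  have h2 : (inner ℂ (y - A x) (y - A x)).re = ‖y - A x‖ ^ 2 := inner_self_eq_norm_sq (𝕜 := ℂ) _
  rw [h2] at h1
  exact sub_eq_zero.1 (norm_eq_zero.1
    (pow_eq_zero_iff two_ne_zero |>.1 (le_antisymm h1 (sq_nonneg _))))

/-- If y is orthogonal to the range, then Re ⟨y, Gy⟩ = 0 and the first variation at y reduces to Re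
⟨x, Gy⟩ = 0 for all x. The choice x = Gy gives Gy = 0, hence y = 0. -/
theorem denseRange_of_injective_of_re_inner_nonpos {G : E →L[ℂ] E}
    (hG : ∀ x, (inner ℂ x (G x)).re ≤ 0) (hinj : Function.Injective G) : DenseRange G := by
  have h : (LinearMap.range (G : E →ₗ[ℂ] E)).topologicalClosure = ⊤ := by
    rw [Submodule.topologicalClosure_eq_top_iff, Submodule.eq_bot_iff]
    intro y hy
    have hy' : ∀ x, inner ℂ y (G x) = 0 := fun x =>
      (Submodule.mem_orthogonal' _ _).1 hy _ ⟨x, rfl⟩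
    have h1 := re_inner_add_re_inner_eq_zero (A := (G : E →ₗ[ℂ] E)) hG (y := y)
      (by simp [hy']) (G y)
    simp only [ContinuousLinearMap.coe_coe, hy', Complex.zero_re, add_zero] at h1
    have h2 : (inner ℂ (G y) (G y)).re = ‖G y‖ ^ 2 := inner_self_eq_norm_sq (𝕜 := ℂ) _
    rw [h2] at h1
    refine hinj ?_
    rw [map_zero]
    exact norm_eq_zero.1 (pow_eq_zero_iff two_ne_zero |>.1 h1)
  have h2 := Submodule.dense_iff_topologicalClosure_eq_top.2 h
  exact h2

open NormedSpace in
theorem norm_exp_smul_apply_le {B : E →L[ℂ] E} (hB : ∀ x, (inner ℂ x (B x)).re ≤ 0) {t : ℝ}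
    (ht : 0 ≤ t) (x : E) : ‖exp (t • B) x‖ ≤ ‖x‖ := by
  have hd : ∀ t : ℝ, HasDerivAt (fun s : ℝ => exp (s • B) x) (B (exp (t • B) x)) t := fun t =>
    ((ContinuousLinearMap.apply ℂ E x).restrictScalars ℝ).hasFDerivAt.comp_hasDerivAt t
      (hasDerivAt_exp_smul_const' B t)
  have := norm_le_norm_zero_of_re_inner_nonpos (fun t _ => (hd t).hasDerivWithinAt)
    (fun t _ => hB _) ht
  simpa using this

-- The path s ↦ exp(sB) exp((t - s)C) x joins exp(tC)x to exp(tB)x. Since B and C commute, its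
-- derivative is a product of contractions applied to Bx - Cx.
open NormedSpace in
theorem norm_exp_smul_sub_exp_smul_le {B C : E →L[ℂ] E} (hBC : Commute B C)
    (hB : ∀ x, (inner ℂ x (B x)).re ≤ 0) (hC : ∀ x, (inner ℂ x (C x)).re ≤ 0) {t : ℝ}
    (ht : 0 ≤ t) (x : E) : ‖exp (t • B) x - exp (t • C) x‖ ≤ t * ‖B x - C x‖ := by
  have hd : ∀ s : ℝ, HasDerivAt (fun s : ℝ => (exp (s • B) * exp ((t - s) • C)) x)
      (exp (s • B) (exp ((t - s) • C) (B x - C x))) s := by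
    intro s
    have h1 := hasDerivAt_exp_smul_const B s
    have h2 : HasDerivAt (fun s : ℝ => exp ((t - s) • C)) (-(exp ((t - s) • C) * C)) s := by
      have := (hasDerivAt_exp_smul_const C (t - s)).scomp s ((hasDerivAt_id s).const_sub t)
      rw [neg_smul, one_smul] at this
      exact this
    have h3 := h1.mul h2
    refine (((ContinuousLinearMap.apply ℂ E x).restrictScalars ℝ).hasFDerivAt.comp_hasDerivAt s
      h3).congr_deriv ?_
    have hc : B * exp ((t - s) • C) = exp ((t - s) • C) * B :=
      ((hBC.smul_right (t - s)).exp_right).eq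
    rw [mul_assoc, hc]
    simp [sub_eq_add_neg]
  have h := norm_image_sub_le_of_norm_deriv_le_segment' (a := 0) (b := t) (C := ‖B x - C x‖)
    (fun s _ => (hd s).hasDerivWithinAt)
    (fun s hs => (norm_exp_smul_apply_le hB hs.1 _).trans
      (norm_exp_smul_apply_le hC (by linarith [hs.2]) _)) t ⟨ht, le_rfl⟩
  simpa [mul_comm] using h

end Dissipative

/-! ### Yosida approximations expressed through the bounded inverse. -/

section Yosida

variable {E : Type*} [NormedAddCommGroup E] [InnerProductSpace ℂ E]

/-- `(G - ε)⁻¹`, which for `G = A⁻¹` is the Yosida approximation `A (1 - ε A)⁻¹` of `A`. -/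
noncomputable def yosida (G : E →L[ℂ] E) (ε : ℝ) : E →L[ℂ] E :=
  Ring.inverse (G - (ε : ℂ) • 1)

variable {G : E →L[ℂ] E} {ε : ℝ}

theorem re_inner_sub_smul (G : E →L[ℂ] E) (ε : ℝ) (x : E) :
    (inner ℂ x ((G - (ε : ℂ) • (1 : E →L[ℂ] E)) x)).re = (inner ℂ x (G x)).re - ε * ‖x‖ ^ 2 := by
  have h2 : (inner ℂ x x).re = ‖x‖ ^ 2 := inner_self_eq_norm_sq (𝕜 := ℂ) _
  simp only [sub_apply, smul_apply, one_apply_eq_self, inner_sub_right,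
    inner_smul_right, Complex.sub_re, Complex.re_ofReal_mul, h2]

theorem commute_yosida (G : E →L[ℂ] E) (ε : ℝ) : Commute G (yosida G ε) := by
  by_cases h : IsUnit (G - (ε : ℂ) • (1 : E →L[ℂ] E))
  · obtain ⟨u, hu⟩ := h
    have h1 : Commute G (u : E →L[ℂ] E) := by
      rw [hu]
      exact (Commute.refl G).sub_right ((Commute.one_right G).smul_right _)
    rw [yosida, ← hu, Ring.inverse_unit]
    exact h1.units_inv_right
  -- `Ring.inverse` is 0 off the units, so the commutation holds for every ε.
  · rw [yosida, Ring.inverse_non_unit _ h]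
    exact Commute.zero_right G

variable [CompleteSpace E]

/-- Lax–Milgram: dissipativity of G gives |⟨x, (G - ε)x⟩| ≥ ε‖x‖². -/
theorem isUnit_sub_smul_one (hG : ∀ x, (inner ℂ x (G x)).re ≤ 0) (hε : 0 < ε) :
    IsUnit (G - (ε : ℂ) • (1 : E →L[ℂ] E)) := by
  refine ContinuousLinearMap.isUnit_of_forall_le_norm_inner_map _ (c := ⟨ε, hε.le⟩) hε fun x => ?_
  have h1 := re_inner_sub_smul G ε x
  rw [norm_inner_symm]
  refine le_trans ?_ (Complex.abs_re_le_norm _)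
  rw [h1, abs_of_nonpos (by nlinarith [hG x, sq_nonneg ‖x‖])]
  change ‖x‖ ^ 2 * ε ≤ _
  linarith [hG x]

theorem sub_smul_yosida (hG : ∀ x, (inner ℂ x (G x)).re ≤ 0) (hε : 0 < ε) (x : E) :
    G (yosida G ε x) - (ε : ℂ) • yosida G ε x = x :=
  DFunLike.congr_fun (Ring.mul_inverse_cancel _ (isUnit_sub_smul_one hG hε)) x

theorem yosida_sub_smul (hG : ∀ x, (inner ℂ x (G x)).re ≤ 0) (hε : 0 < ε) (x : E) :
    yosida G ε (G x) - (ε : ℂ) • yosida G ε x = x := by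
  have := DFunLike.congr_fun (Ring.inverse_mul_cancel _ (isUnit_sub_smul_one hG hε)) x
  simpa [yosida] using this

/-- Put y = (G - ε)⁻¹x and expand Re ⟨y, (G - ε)y⟩. This one inequality yields both the
dissipativity of the approximation and the uniform bound ‖ε(G - ε)⁻¹‖ ≤ 1. -/
theorem re_inner_yosida_add (hG : ∀ x, (inner ℂ x (G x)).re ≤ 0) (hε : 0 < ε) (x : E) :

    (inner ℂ x (yosida G ε x)).re + ε * ‖yosida G ε x‖ ^ 2 ≤ 0 := by
  have h1 := re_inner_sub_smul G ε (yosida G ε x)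
  have h2 : (G - (ε : ℂ) • (1 : E →L[ℂ] E)) (yosida G ε x) = x := sub_smul_yosida hG hε x
  rw [h2, ← inner_conj_symm, Complex.conj_re] at h1
  linarith [hG (yosida G ε x)]

theorem re_inner_yosida_nonpos (hG : ∀ x, (inner ℂ x (G x)).re ≤ 0) (hε : 0 < ε) (x : E) :
    (inner ℂ x (yosida G ε x)).re ≤ 0 := by
  nlinarith [re_inner_yosida_add hG hε x, mul_nonneg hε.le (sq_nonneg ‖yosida G ε x‖)]

theorem mul_norm_yosida_le (hG : ∀ x, (inner ℂ x (G x)).re ≤ 0) (hε : 0 < ε) (x : E) :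
    ε * ‖yosida G ε x‖ ≤ ‖x‖ := by
  have h1 := re_inner_yosida_add hG hε x
  have h2 : -(inner ℂ x (yosida G ε x)).re ≤ ‖x‖ * ‖yosida G ε x‖ :=
    (neg_le_abs _).trans ((Complex.abs_re_le_norm _).trans (norm_inner_le_norm _ _))
  rcases (norm_nonneg (yosida G ε x)).eq_or_lt with h | h
  · rw [← h, mul_zero]; exact norm_nonneg x
  · refine le_of_mul_le_mul_right ?_ h
    nlinarith

theorem commute_yosida_yosida (hG : ∀ x, (inner ℂ x (G x)).re ≤ 0)
    {ε δ : ℝ} (hε : 0 < ε) :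
    Commute (yosida G ε) (yosida G δ) := by
  obtain ⟨u, hu⟩ := isUnit_sub_smul_one hG hε
  have h1 : Commute (u : E →L[ℂ] E) (yosida G δ) := by
    rw [hu]
    exact (commute_yosida G δ).sub_left ((Commute.one_left _).smul_left _)
  rw [yosida, ← hu, Ring.inverse_unit]
  exact h1.units_inv_left

/-- This is the convergence of the Yosida approximations to A on D(A). The error is ε(G - ε)⁻¹z. It
is O(ε) when z = Gw, and the uniform bound on ε(G - ε)⁻¹ extends the convergence to all z by
density. -/
theorem tendsto_yosida_apply (hG : ∀ x, (inner ℂ x (G x)).re ≤ 0)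
    (hd : DenseRange G) (z : E) :
    Tendsto (fun ε : ℝ => yosida G ε (G z)) (𝓝[>] 0) (𝓝 z) := by
  rw [Metric.tendsto_nhds]
  intro δ hδ
  obtain ⟨w, hw⟩ := hd.exists_dist_lt z (half_pos hδ)
  have h1 : ∀ᶠ ε : ℝ in 𝓝[>] 0, ε * (2 * ‖w‖) < δ / 2 := by
    have : Tendsto (fun ε : ℝ => ε * (2 * ‖w‖)) (𝓝[>] 0) (𝓝 (0 * (2 * ‖w‖))) :=
      (tendsto_id.mono_left nhdsWithin_le_nhds).mul_const _
    rw [zero_mul] at this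
    exact this.eventually_lt_const (half_pos hδ)
  filter_upwards [h1, self_mem_nhdsWithin] with ε h2 hε
  have hε' : (0 : ℝ) < ε := hε
  have e1 : yosida G ε (G z) - z = (ε : ℂ) • yosida G ε z := by
    rw [sub_eq_iff_eq_add, ← sub_eq_iff_eq_add', yosida_sub_smul hG hε']
  have n : ∀ y : E, ‖(ε : ℂ) • y‖ = ε * ‖y‖ := fun y => by
    rw [norm_smul, Complex.norm_real, Real.norm_of_nonneg hε'.le]
  have e2 : yosida G ε z = yosida G ε (z - G w) + (w + (ε : ℂ) • yosida G ε w) := by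
    have := yosida_sub_smul hG hε' w
    rw [map_sub]
    rw [eq_add_of_sub_eq this]; abel
  rw [dist_eq_norm, e1, e2, smul_add]
  refine (norm_add_le _ _).trans_lt ?_
  rw [n, n]
  have b1 := mul_norm_yosida_le hG hε' (z - G w)
  have b2 := mul_norm_yosida_le hG hε' w
  have b3 : ‖w + (ε : ℂ) • yosida G ε w‖ ≤ 2 * ‖w‖ := by
    refine (norm_add_le _ _).trans ?_
    rw [n]; linarith
  rw [dist_eq_norm] at hw
  nlinarith [mul_le_mul_of_nonneg_left b3 hε'.le]

end Yosida

/-! ### The semigroup as a strong limit, and the Lumer–Phillips theorem. -/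

section Generation

variable {E : Type*} [NormedAddCommGroup E] [InnerProductSpace ℂ E] [CompleteSpace E]
  {G : E →L[ℂ] E}

/-- The exponentials of the Yosida approximations. -/
noncomputable def yosidaExp (G : E →L[ℂ] E) (n : ℕ) (t : ℝ) : E →L[ℂ] E :=
  -- Freezing negative times at 0 makes the contraction bound and continuity in t available on all
  -- of ℝ.
  NormedSpace.exp (max t 0 • yosida G (1 / ((n : ℝ) + 1)))

theorem yosidaExp_of_nonneg (G : E →L[ℂ] E) (n : ℕ) {t : ℝ} (ht : 0 ≤ t) :
    yosidaExp G n t = NormedSpace.exp (t • yosida G (1 / ((n : ℝ) + 1))) := by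
  rw [yosidaExp, max_eq_left ht]

theorem continuous_yosidaExp (G : E →L[ℂ] E) (n : ℕ) : Continuous (yosidaExp G n) :=
  let _ := NormedAlgebra.restrictScalars ℚ ℝ (E →L[ℂ] E)
  NormedSpace.exp_continuous.comp ((continuous_id.max continuous_const).smul continuous_const)

theorem commute_yosidaExp (G : E →L[ℂ] E) (n : ℕ) (t : ℝ) : Commute G (yosidaExp G n t) :=
  ((commute_yosida G _).smul_right _).exp_right

theorem norm_yosidaExp_apply_le (hG : ∀ x, (inner ℂ x (G x)).re ≤ 0) (n : ℕ) (t : ℝ) (x : E) :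
    ‖yosidaExp G n t x‖ ≤ ‖x‖ :=
  norm_exp_smul_apply_le (re_inner_yosida_nonpos hG Nat.one_div_pos_of_nat) (le_max_right _ _) x

theorem tendsto_yosida_nat (hG : ∀ x, (inner ℂ x (G x)).re ≤ 0) (hd : DenseRange G) (z : E) :
    Tendsto (fun n : ℕ => yosida G (1 / ((n : ℝ) + 1)) (G z)) atTop (𝓝 z) :=
  (tendsto_yosida_apply hG hd z).comp <| tendsto_nhdsWithin_iff.2
    ⟨tendsto_one_div_add_atTop_nhds_zero_nat, Eventually.of_forall fun _ =>
      mem_Ioi.2 Nat.one_div_pos_of_nat⟩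

/-- At a point Gz two exponentials differ by at most t times the difference of the generators at Gz,
and that difference is Cauchy. The contraction bound carries this over to the closure of the range,
which is everything. -/
theorem cauchySeq_yosidaExp (hG : ∀ x, (inner ℂ x (G x)).re ≤ 0) (hd : DenseRange G) (t : ℝ)
    (x : E) : CauchySeq fun n => yosidaExp G n t x := by
  rw [Metric.cauchySeq_iff]
  intro δ hδ
  obtain ⟨z, hz⟩ := hd.exists_dist_lt x (show 0 < δ / 4 by positivity)
  set T := max t 0 with hT
  have hT0 : 0 ≤ T := le_max_right _ _
  have hc := (tendsto_yosida_nat hG hd z).cauchySeq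
  -- Multiplying this tolerance by T leaves at most δ / 2; the summand 1 covers T = 0.
  obtain ⟨N, hN⟩ := Metric.cauchySeq_iff.1 hc (δ / (2 * (T + 1))) (by positivity)
  refine ⟨N, fun m hm n hn => ?_⟩
  have h1 := hN m hm n hn
  have h2 : ‖yosidaExp G m t (G z) - yosidaExp G n t (G z)‖ ≤ δ / 2 := by
    refine (norm_exp_smul_sub_exp_smul_le
      (commute_yosida_yosida hG Nat.one_div_pos_of_nat)
      (re_inner_yosida_nonpos hG Nat.one_div_pos_of_nat)
      (re_inner_yosida_nonpos hG Nat.one_div_pos_of_nat) hT0 _).trans ?_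
    rw [dist_eq_norm] at h1
    refine (mul_le_mul_of_nonneg_left h1.le hT0).trans ?_
    rw [mul_div_assoc', div_le_div_iff₀ (by positivity) two_pos]
    nlinarith
  have h3 : ∀ n, ‖yosidaExp G n t (x - G z)‖ < δ / 4 := fun n =>
    (norm_yosidaExp_apply_le hG n t _).trans_lt (by rwa [dist_eq_norm] at hz)
  have e : yosidaExp G m t x - yosidaExp G n t x = yosidaExp G m t (x - G z)
      - yosidaExp G n t (x - G z) + (yosidaExp G m t (G z) - yosidaExp G n t (G z)) := by
    simp only [map_sub]; abel
  rw [dist_eq_norm, e]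
  have := norm_add_le (yosidaExp G m t (x - G z) - yosidaExp G n t (x - G z))
    (yosidaExp G m t (G z) - yosidaExp G n t (G z))
  have := norm_sub_le (yosidaExp G m t (x - G z)) (yosidaExp G n t (x - G z))
  linarith [h3 m, h3 n]

theorem exists_tendsto_yosidaExp (hG : ∀ x, (inner ℂ x (G x)).re ≤ 0) (hd : DenseRange G) :
    ∃ S : ℝ → E →L[ℂ] E, ∀ t x, Tendsto (fun n => yosidaExp G n t x) atTop (𝓝 (S t x)) := by
  choose f hf using fun t x => cauchySeq_tendsto_of_complete (cauchySeq_yosidaExp hG hd t x)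
  exact ⟨fun t => continuousLinearMapOfTendsto _ (tendsto_pi_nhds.2 (hf t)), hf⟩

/-- The integrated form of the evolution equation passes to the limit by dominated convergence, with
no convergence of derivatives required. -/
theorem yosidaExp_apply_sub_eq_integral (G : E →L[ℂ] E) (n : ℕ) (x : E) {s t : ℝ}
    (hs : 0 ≤ s) (hst : s ≤ t) : yosidaExp G n t x - yosidaExp G n s x
      = ∫ r in s..t, yosidaExp G n r (yosida G (1 / ((n : ℝ) + 1)) x) := by
  set Y := yosida G (1 / ((n : ℝ) + 1)) with hY
  have hd : ∀ t : ℝ, HasDerivAt (fun s : ℝ => NormedSpace.exp (s • Y) x)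
      (NormedSpace.exp (t • Y) (Y x)) t := fun t =>
    ((ContinuousLinearMap.apply ℂ E x).restrictScalars ℝ).hasFDerivAt.comp_hasDerivAt t
      (hasDerivAt_exp_smul_const Y t)
  let _ := NormedAlgebra.restrictScalars ℚ ℝ (E →L[ℂ] E)
  have hc : Continuous fun r : ℝ => NormedSpace.exp (r • Y) (Y x) :=
    (ContinuousLinearMap.apply ℂ E (Y x)).continuous.comp
      (NormedSpace.exp_continuous.comp (continuous_id.smul continuous_const))
  rw [yosidaExp_of_nonneg G n hs, yosidaExp_of_nonneg G n (hs.trans hst), ← hY,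
    ← intervalIntegral.integral_eq_sub_of_hasDerivAt (fun r _ => hd r)
      (hc.intervalIntegrable _ _)]
  refine intervalIntegral.integral_congr fun r hr => ?_
  rw [uIcc_of_le hst] at hr
  simp only [yosidaExp_of_nonneg G n (hs.trans hr.1), ← hY]

/-- An injective bounded dissipative operator `G` on a Hilbert space is the inverse of the
generator of a contraction semigroup. -/
theorem exists_contractionSemigroup (hG : ∀ x, (inner ℂ x (G x)).re ≤ 0)
    (hinj : Function.Injective G) : ∃ S : ℝ → E →L[ℂ] E, IsContractionSemigroup S ∧
      (∀ x, Continuous fun t => S t x) ∧ (∀ t x, S t (G x) = G (S t x)) ∧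
      ∀ x t, 0 ≤ t → S t (G x) = G x + ∫ s in (0 : ℝ)..t, S s x := by
  have hd := denseRange_of_injective_of_re_inner_nonpos hG hinj
  obtain ⟨S, hS⟩ := exists_tendsto_yosidaExp hG hd
  have hle : ∀ t x, ‖S t x‖ ≤ ‖x‖ := fun t x =>
    le_of_tendsto' (hS t x).norm fun n => norm_yosidaExp_apply_le hG n t x
  have h0 : ∀ x, S 0 x = x := fun x =>
    tendsto_nhds_unique (hS 0 x) (by simp [yosidaExp])
  have hSG : ∀ t x, S t (G x) = G (S t x) := fun t x =>
    tendsto_nhds_unique (hS t (G x)) <| ((G.continuous.tendsto _).comp (hS t x)).congr fun n =>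
      DFunLike.congr_fun (commute_yosidaExp G n t).eq x
  -- Uniform contractivity lets the argument vary along with the operator.
  have hbd : ∀ (x : E) (f : ℕ → E), Tendsto f atTop (𝓝 x) → ∀ t,
      Tendsto (fun n => yosidaExp G n t (f n)) atTop (𝓝 (S t x)) := by
    intro x f hf t
    have h1 : Tendsto (fun n => yosidaExp G n t (f n - x)) atTop (𝓝 0) := by
      refine squeeze_zero_norm (fun n => norm_yosidaExp_apply_le hG n t _) ?_
      exact tendsto_iff_norm_sub_tendsto_zero.1 hf
    have h2 := h1.add (hS t x)
    rw [zero_add] at h2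
    exact h2.congr fun n => by rw [map_sub, sub_add_cancel]
  have hadd : ∀ s t, 0 ≤ s → 0 ≤ t → ∀ x, S (s + t) x = S s (S t x) := fun s t hs ht x =>
    tendsto_nhds_unique (hS (s + t) x) <| (hbd _ _ (hS t x) s).congr fun n => by
      let _ := NormedAlgebra.restrictScalars ℚ ℝ (E →L[ℂ] E)
      rw [yosidaExp_of_nonneg G n hs, yosidaExp_of_nonneg G n ht,
        yosidaExp_of_nonneg G n (add_nonneg hs ht), add_smul,
        NormedSpace.exp_add_of_commute ((Commute.refl _).smul_left s |>.smul_right t)]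
      rfl
  have hmeas : ∀ x, StronglyMeasurable fun t => S t x := fun x =>
    stronglyMeasurable_of_tendsto atTop (f := fun n t => yosidaExp G n t x)
      (fun n => ((ContinuousLinearMap.apply ℂ E x).continuous.comp
        (continuous_yosidaExp G n)).stronglyMeasurable) (tendsto_pi_nhds.2 fun t => hS t x)
  -- At Gx the approximate generators converge to x, so the integrands are bounded and converge
  -- pointwise to S(r)x.
  have hint : ∀ x s t, 0 ≤ s → s ≤ t → S t (G x) - S s (G x) = ∫ r in s..t, S r x := by
    intro x s t hs hst
    have hY := tendsto_yosida_nat hG hd x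
    obtain ⟨C, hC⟩ := hY.norm.bddAbove_range
    refine tendsto_nhds_unique ((hS t (G x)).sub (hS s (G x))) ?_
    simp only [yosidaExp_apply_sub_eq_integral G _ _ hs hst]
    refine intervalIntegral.tendsto_integral_filter_of_dominated_convergence (fun _ => C)
      ?_ ?_ intervalIntegrable_const ?_
    · exact Eventually.of_forall fun n => ((ContinuousLinearMap.apply ℂ E _).continuous.comp
        (continuous_yosidaExp G n)).aestronglyMeasurable
    · exact Eventually.of_forall fun n => Eventually.of_forall fun r _ =>
        (norm_yosidaExp_apply_le hG n r _).trans (hC ⟨n, rfl⟩)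
    · exact Eventually.of_forall fun r _ => hbd _ _ hY r
  have hlip : ∀ x s t, 0 ≤ s → s ≤ t → ‖S t (G x) - S s (G x)‖ ≤ ‖x‖ * |t - s| := by
    intro x s t hs hst
    rw [hint x s t hs hst]
    exact intervalIntegral.norm_integral_le_of_norm_le_const fun r _ => hle r x
  have hmax : ∀ t, S t = S (max t 0) := fun t => ContinuousLinearMap.ext fun x =>
    tendsto_nhds_unique (hS t x) <| (hS (max t 0) x).congr fun n => by
      simp only [yosidaExp, max_assoc, max_self]
  have hlip' : ∀ x s t, ‖S t (G x) - S s (G x)‖ ≤ ‖x‖ * |t - s| := by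
    intro x s t
    have h1 : |max t 0 - max s 0| ≤ |t - s| := abs_max_sub_max_le_abs t s 0
    refine le_trans ?_ (mul_le_mul_of_nonneg_left h1 (norm_nonneg x))
    rw [hmax t, hmax s]
    rcases le_total (max s 0) (max t 0) with h | h
    · exact hlip x _ _ (le_max_right _ _) h
    · rw [norm_sub_rev, abs_sub_comm]
      exact hlip x _ _ (le_max_right _ _) h
  -- Orbits starting in the range of G are Lipschitz in time. Density and ‖S(t)‖ ≤ 1 give continuity
  -- of every orbit.
  have hcont : ∀ x, Continuous fun t => S t x := by
    intro x
    rw [Metric.continuous_iff]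
    intro t δ hδ
    obtain ⟨z, hz⟩ := hd.exists_dist_lt x (show 0 < δ / 4 by positivity)
    refine ⟨δ / (4 * (‖z‖ + 1)), by positivity, fun s hs => ?_⟩
    rw [dist_eq_norm] at hz ⊢
    have e : S s x - S t x = S s (x - G z) - S t (x - G z) + (S s (G z) - S t (G z)) := by
      simp only [map_sub]; abel
    have b1 := hle s (x - G z)
    have b2 := hle t (x - G z)
    have b3 := hlip' z t s
    have b4 : ‖z‖ * |s - t| ≤ δ / 4 := by
      rw [Real.dist_eq, lt_div_iff₀ (by positivity)] at hs
      nlinarith [abs_nonneg (s - t), norm_nonneg z]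
    rw [e]
    have := norm_add_le (S s (x - G z) - S t (x - G z)) (S s (G z) - S t (G z))
    have := norm_sub_le (S s (x - G z)) (S t (x - G z))
    linarith
  refine ⟨S, ⟨ContinuousLinearMap.ext h0, fun s t hs ht => ContinuousLinearMap.ext
    (hadd s t hs ht), fun x => ?_, fun t _ => ?_⟩, hcont, hSG, fun x t ht => ?_⟩
  · have := (hcont x).tendsto 0
    rw [h0] at this
    exact this.mono_left nhdsWithin_le_nhds
  · exact ContinuousLinearMap.opNorm_le_bound _ zero_le_one fun x => by
      rw [one_mul]; exact hle t x
  · rw [← hint x 0 t le_rfl ht, h0]; abel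

/-- **Lumer–Phillips theorem**, for a dissipative operator on a Hilbert space which is onto,
together with the well-posedness of the Cauchy problem. -/
theorem exists_contractionSemigroup_isGenerator {A : E →ₗ.[ℂ] E}
    (hA : ∀ x : A.domain, (inner ℂ (x : E) (A x)).re ≤ 0) (hsurj : ∀ y, ∃ x, A x = y) :
    ∃ S : ℝ → E →L[ℂ] E, IsContractionSemigroup S ∧ IsGenerator A S ∧
      ∀ U₀ ∈ A.domain, IsSolution A U₀ (fun t => S t U₀) ∧
        IsContinuousInDomain A (fun t => S t U₀) ∧ ContDiffOn ℝ 1 (fun t => S t U₀) (Ici 0) ∧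
        ∀ U : ℝ → E, IsSolution A U₀ U → ∀ t, 0 ≤ t → U t = S t U₀ := by
  have hker : ∀ x : A.domain, A x = 0 → x = 0 := by
    intro x hx
    obtain ⟨y, hy⟩ := hsurj x
    -- With Ay = x and Ax = 0, dissipativity at y + tx is an affine inequality in t, valid on all of
    -- ℝ, with slope ‖x‖². Hence x = 0.
    have key : ∀ t : ℝ, (inner ℂ (y : E) (x : E)).re + t * ‖(x : E)‖ ^ 2 ≤ 0 := by
      intro t
      have h1 := hA (y + (t : ℂ) • x)
      have h2 : (inner ℂ (x : E) (x : E)).re = ‖(x : E)‖ ^ 2 :=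
        inner_self_eq_norm_sq (𝕜 := ℂ) _
      rwa [A.map_add, A.map_smul, hx, hy, smul_zero, add_zero, Submodule.coe_add,
        Submodule.coe_smul, inner_add_left, inner_smul_left, Complex.conj_ofReal,
        Complex.add_re, Complex.re_ofReal_mul, h2] at h1
    by_contra hne
    have hpos : 0 < ‖(x : E)‖ ^ 2 := by
      have : (x : E) ≠ 0 := fun h => hne (Subtype.ext h)
      positivity
    have h3 := key ((1 - (inner ℂ (y : E) (x : E)).re) / ‖(x : E)‖ ^ 2)
    rw [div_mul_cancel₀ _ hpos.ne'] at h3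
    linarith
  have hinj : ∀ x y : A.domain, A x = A y → x = y := fun x y h =>
    sub_eq_zero.1 (hker _ (by rw [A.map_sub, h, sub_self]))
  choose g hg using hsurj
  let G₀ : E →ₗ[ℂ] E :=
    { toFun := fun y => g y
      map_add' := fun y z => by
        rw [← Submodule.coe_add]
        exact congrArg _ (hinj _ _ (by rw [A.map_add, hg, hg, hg]))
      map_smul' := fun c y => by
        rw [RingHom.id_apply, ← Submodule.coe_smul]
        exact congrArg _ (hinj _ _ (by rw [A.map_smul, hg, hg])) }
  have hG₀ : ∀ y, (inner ℂ y (G₀ y)).re ≤ 0 := fun y => by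
    have := hA (g y)
    rwa [hg, ← inner_conj_symm, Complex.conj_re] at this
  let G : E →L[ℂ] E := ⟨G₀, continuous_of_re_inner_nonpos hG₀⟩
  have hgraph : ∀ x y, (x, y) ∈ A.graph ↔ G y = x := by
    intro x y
    rw [LinearPMap.mem_graph_iff]
    constructor
    · rintro ⟨z, rfl, rfl⟩
      exact congrArg Subtype.val (hinj (g (A z)) z (hg _))
    · rintro rfl
      exact ⟨g y, rfl, hg y⟩
  have hGinj : Function.Injective G := fun y z h => by
    rw [← hg y, ← hg z]; exact congrArg A (Subtype.ext h)
  obtain ⟨S, hS, hcont, hSG, hint⟩ := exists_contractionSemigroup (G := G) hG₀ hGinj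
  have h0 : ∀ x, S 0 x = x := fun x => by rw [hS.zero]; rfl
  have hFd : ∀ x t, HasDerivAt (fun t => G x + ∫ s in (0 : ℝ)..t, S s x) (S t x) t := fun x t =>
    ((hcont x).integral_hasStrictDerivAt 0 t).hasDerivAt.const_add _
  have hd : ∀ x t, 0 ≤ t → HasDerivWithinAt (fun t => S t (G x)) (S t x) (Ici 0) t := fun x t ht =>
    (hFd x t).hasDerivWithinAt.congr_of_mem (fun s hs => hint x s hs) ht
  have hlim : ∀ x, Tendsto (fun t : ℝ => t⁻¹ • (S t (G x) - G x)) (𝓝[>] 0) (𝓝 x) := by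
    intro x
    have h1 := (hd x 0 le_rfl).mono Ioi_subset_Ici_self
    rw [hasDerivWithinAt_iff_tendsto_slope' (by simp), h0] at h1
    refine h1.congr fun t => ?_
    rw [slope_def_module, sub_zero, h0]
  refine ⟨S, hS, fun x y => ?_, fun U₀ hU₀ => ?_⟩
  · rw [hgraph]
    constructor
    · rintro rfl
      exact hlim y
    -- Applying G to the difference quotient of x gives the difference quotient of Gx, which tends
    -- to x; by continuity of G it also tends to Gy.
    · intro h
      have h1 := (G.continuous.tendsto _).comp h
      refine tendsto_nhds_unique h1 ((hlim x).congr fun t => ?_)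
      rw [Function.comp_apply, hSG, ← map_sub, G.map_smul_of_tower]
  · obtain ⟨z, rfl⟩ : ∃ z, G z = U₀ :=
      ⟨A ⟨U₀, hU₀⟩, (hgraph _ _).1 (A.mem_graph ⟨U₀, hU₀⟩)⟩
    have hsol : IsSolution A (G z) fun t => S t (G z) :=
      ⟨h0 _, fun t ht => ⟨S t z, (hgraph _ _).2 (hSG t z).symm, hd z t ht⟩⟩
    refine ⟨hsol, ⟨fun t => S t z, fun t _ => (hgraph _ _).2 (hSG t z).symm,
      (hcont _).continuousOn, (hcont _).continuousOn⟩, ?_, fun U hU t ht => ?_⟩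
    -- On [0,∞) the orbit coincides with a primitive of a continuous function that is C¹ on the
    -- whole line.
    · have h1 : ContDiff ℝ 1 fun t => G z + ∫ s in (0 : ℝ)..t, S s z := by
        rw [contDiff_one_iff_deriv, funext fun t => (hFd z t).deriv]
        exact ⟨fun t => (hFd z t).differentiableAt, hcont z⟩
      exact h1.contDiffOn.congr fun t ht => hint z t ht
    · have hW : ∀ t, ∃ W, 0 ≤ t → (U t, W) ∈ A.graph ∧ HasDerivWithinAt U W (Ici 0) t := by
        intro t
        by_cases ht : 0 ≤ t
        · obtain ⟨W, hW⟩ := hU.equation t ht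
          exact ⟨W, fun _ => hW⟩
        · exact ⟨0, fun h => absurd h ht⟩
      choose W hW using hW
      -- The difference u of the two solutions satisfies u = Gu', so dissipativity of G gives Re ⟨u,
      -- u'⟩ ≤ 0, while u(0) = 0.
      have h1 := norm_le_norm_zero_of_re_inner_nonpos (u := fun t => U t - S t (G z))
        (u' := fun t => W t - S t z) (fun t ht => (hW t ht).2.sub (hd z t ht)) (fun t ht => ?_) ht
      · rw [hU.initial, h0, sub_self, norm_zero] at h1
        exact sub_eq_zero.1 (norm_le_zero_iff.1 h1)
      · have h2 := hG₀ (W t - S t z)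
        have h3 : G (W t - S t z) = U t - S t (G z) := by
          rw [map_sub, (hgraph _ _).1 (hW t ht).1, hSG]
        rw [← inner_conj_symm, Complex.conj_re] at h2
        rw [← h3]
        exact h2

end Generation

namespace PiezoBeam

/-! ### Primitives, boundary values and integration by parts in H¹(0,L). -/

section Primitive

variable {L : ℝ}

theorem intervalIntegrable_clm_comp {F : Type*} [NormedAddCommGroup F] [NormedSpace ℝ F]
    (T : ℂ →L[ℝ] F) {f : ℝ → ℂ} (h : IntervalIntegrable f volume 0 L) :
    IntervalIntegrable (fun x => T (f x)) volume 0 L :=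
  ⟨T.integrable_comp h.1, T.integrable_comp h.2⟩

theorem intervalIntegrable_re {f : ℝ → ℂ} (h : IntervalIntegrable f volume 0 L) :
    IntervalIntegrable (fun x => (f x).re) volume 0 L :=
  intervalIntegrable_clm_comp Complex.reCLM h

theorem intervalIntegrable_im {f : ℝ → ℂ} (h : IntervalIntegrable f volume 0 L) :
    IntervalIntegrable (fun x => (f x).im) volume 0 L :=
  intervalIntegrable_clm_comp Complex.imCLM h

/-- Primitives of integrable functions are absolutely continuous, so they can be integrated by
parts; their derivatives are f and g almost everywhere, and they vanish at 0. -/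
theorem integral_primitive_mul_add_real {f g : ℝ → ℝ} (hf : IntervalIntegrable f volume 0 L)
    (hg : IntervalIntegrable g volume 0 L) :
    (∫ x in (0 : ℝ)..L, (∫ t in (0 : ℝ)..x, f t) * g x)
      + ∫ x in (0 : ℝ)..L, (∫ t in (0 : ℝ)..x, g t) * f x
      = (∫ t in (0 : ℝ)..L, f t) * ∫ t in (0 : ℝ)..L, g t := by
  have hF := hf.absolutelyContinuousOnInterval_intervalIntegral (c := 0) (by simp)
  have hG := hg.absolutelyContinuousOnInterval_intervalIntegral (c := 0) (by simp)
  have h := hF.integral_mul_deriv_eq_deriv_mul hG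
  have e1 : ∫ x in (0 : ℝ)..L, (∫ t in (0 : ℝ)..x, f t) * deriv (fun x => ∫ t in (0 : ℝ)..x, g t) x
      = ∫ x in (0 : ℝ)..L, (∫ t in (0 : ℝ)..x, f t) * g x := by
    apply intervalIntegral.integral_congr_ae
    filter_upwards [hg.ae_hasDerivAt_integral] with x hx hx'
    rw [(hx (uIoc_subset_uIcc hx') 0 (by simp)).deriv]
  have e2 : ∫ x in (0 : ℝ)..L, deriv (fun x => ∫ t in (0 : ℝ)..x, f t) x * (∫ t in (0 : ℝ)..x, g t)
      = ∫ x in (0 : ℝ)..L, (∫ t in (0 : ℝ)..x, g t) * f x := by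
    apply intervalIntegral.integral_congr_ae
    filter_upwards [hf.ae_hasDerivAt_integral] with x hx hx'
    rw [(hx (uIoc_subset_uIcc hx') 0 (by simp)).deriv, mul_comm]
  rw [e1, e2] at h
  simp only [intervalIntegral.integral_same, zero_mul, sub_zero] at h
  linarith

theorem intervalIntegrable_primitive_mul {𝕜 : Type*} [RCLike 𝕜] {f g : ℝ → 𝕜}
    (hf : IntervalIntegrable f volume 0 L) (hg : IntervalIntegrable g volume 0 L) :
    IntervalIntegrable (fun x => (∫ t in (0 : ℝ)..x, f t) * g x) volume 0 L :=
  hg.continuousOn_mul (intervalIntegral.continuousOn_primitive_interval' hf (by simp))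

/-- Separating real and imaginary parts reduces the complex integration by parts to four real ones.
-/
theorem integral_primitive_mul_eq {f g : ℝ → ℂ} (hf : IntervalIntegrable f volume 0 L)
    (hg : IntervalIntegrable g volume 0 L) :
    ∫ x in (0 : ℝ)..L, (∫ t in (0 : ℝ)..x, f t) * g x =
      (((∫ x in (0 : ℝ)..L, (∫ t in (0 : ℝ)..x, (f t).re) * (g x).re)
        - (∫ x in (0 : ℝ)..L, (∫ t in (0 : ℝ)..x, (f t).im) * (g x).im) : ℝ) : ℂ)
      + (((∫ x in (0 : ℝ)..L, (∫ t in (0 : ℝ)..x, (f t).re) * (g x).im)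
        + ∫ x in (0 : ℝ)..L, (∫ t in (0 : ℝ)..x, (f t).im) * (g x).re : ℝ) : ℂ) * Complex.I := by
  have hsub : ∀ x ∈ uIcc 0 L, IntervalIntegrable f volume 0 x := fun x hx =>
    hf.mono_set (uIcc_subset_uIcc_left hx)
  have er : ∀ x ∈ uIcc 0 L, ∫ t in (0 : ℝ)..x, (f t).re = (∫ t in (0 : ℝ)..x, f t).re :=
    fun x hx => Complex.reCLM.intervalIntegral_comp_comm (hsub x hx)
  have ei : ∀ x ∈ uIcc 0 L, ∫ t in (0 : ℝ)..x, (f t).im = (∫ t in (0 : ℝ)..x, f t).im :=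
    fun x hx => Complex.imCLM.intervalIntegral_comp_comm (hsub x hx)
  have hi := intervalIntegrable_primitive_mul hf hg
  have k1 := Complex.reCLM.intervalIntegral_comp_comm hi
  have k2 := Complex.imCLM.intervalIntegral_comp_comm hi
  rw [← intervalIntegral.integral_sub
      (intervalIntegrable_primitive_mul (intervalIntegrable_re hf) (intervalIntegrable_re hg))
      (intervalIntegrable_primitive_mul (intervalIntegrable_im hf) (intervalIntegrable_im hg)),
    ← intervalIntegral.integral_add
      (intervalIntegrable_primitive_mul (intervalIntegrable_re hf) (intervalIntegrable_im hg))
      (intervalIntegrable_primitive_mul (intervalIntegrable_im hf) (intervalIntegrable_re hg))]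
  rw [← Complex.re_add_im (∫ x in (0 : ℝ)..L, (∫ t in (0 : ℝ)..x, f t) * g x)]
  congr 3
  · rw [← Complex.reCLM_apply, ← k1]
    refine intervalIntegral.integral_congr fun x hx => ?_
    simp only [Complex.reCLM_apply, Complex.mul_re, er x hx, ei x hx]
  · rw [← Complex.imCLM_apply, ← k2]
    refine intervalIntegral.integral_congr fun x hx => ?_
    simp only [Complex.imCLM_apply, Complex.mul_im, er x hx, ei x hx]

/-- Integration by parts for primitives of integrable functions. -/
theorem integral_primitive_mul_add {f g : ℝ → ℂ} (hf : IntervalIntegrable f volume 0 L)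
    (hg : IntervalIntegrable g volume 0 L) :
    (∫ x in (0 : ℝ)..L, (∫ t in (0 : ℝ)..x, f t) * g x)
      + ∫ x in (0 : ℝ)..L, (∫ t in (0 : ℝ)..x, g t) * f x
      = (∫ t in (0 : ℝ)..L, f t) * ∫ t in (0 : ℝ)..L, g t := by
  have e : ∀ {f : ℝ → ℂ}, IntervalIntegrable f volume 0 L → ∫ t in (0 : ℝ)..L, f t
      = ((∫ t in (0 : ℝ)..L, (f t).re : ℝ) : ℂ)
        + ((∫ t in (0 : ℝ)..L, (f t).im : ℝ) : ℂ) * Complex.I := by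
    intro f h
    rw [← Complex.re_add_im (∫ t in (0 : ℝ)..L, f t)]
    congr 3
    · exact (Complex.reCLM.intervalIntegral_comp_comm h).symm
    · exact (Complex.imCLM.intervalIntegral_comp_comm h).symm
  rw [integral_primitive_mul_eq hf hg, integral_primitive_mul_eq hg hf, e hf, e hg]
  have r1 := integral_primitive_mul_add_real (intervalIntegrable_re hf) (intervalIntegrable_re hg)
  have r2 := integral_primitive_mul_add_real (intervalIntegrable_re hf) (intervalIntegrable_im hg)
  have r3 := integral_primitive_mul_add_real (intervalIntegrable_im hf) (intervalIntegrable_re hg)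
  have r4 := integral_primitive_mul_add_real (intervalIntegrable_im hf) (intervalIntegrable_im hg)
  apply_fun ((↑) : ℝ → ℂ) at r1 r2 r3 r4
  push_cast at r1 r2 r3 r4 ⊢
  linear_combination r1 - r4 + Complex.I * (r2 + r3)
    - Complex.ofReal (∫ t in (0 : ℝ)..L, (f t).im) * Complex.ofReal (∫ t in (0 : ℝ)..L, (g t).im)
      * Complex.I_sq

theorem L2I.intervalIntegrable (hL : 0 < L) (w : L2I L) : IntervalIntegrable w volume 0 L := by
  rw [intervalIntegrable_iff_integrableOn_Ioo_of_le hL.le]; exact w.integrable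

theorem intervalIntegral_eq_integral_Ioo (hL : 0 < L) (f : ℝ → ℂ) :
    ∫ x in (0 : ℝ)..L, f x = ∫ x in Ioo 0 L, f x := by
  rw [intervalIntegral.integral_of_le hL.le, integral_Ioc_eq_integral_Ioo]

theorem continuousOn_primitive (hL : 0 < L) (c : ℂ) (w : L2I L) :
    ContinuousOn (fun x => c + ∫ t in (0 : ℝ)..x, w t) (Icc 0 L) := by
  have := intervalIntegral.continuousOn_primitive_interval' (L2I.intervalIntegrable hL w) (a := 0)
    (by simp)
  rw [uIcc_of_le hL.le] at this
  exact continuousOn_const.add this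

theorem evalAt_eq_of_ae_eq (hL : 0 < L) {u : H1 L} {w : L2I L} {c : ℂ}
    (h : ((u : L2I L) : ℝ → ℂ) =ᵐ[volume.restrict (Ioo (0 : ℝ) L)]
      fun x => c + ∫ t in (0 : ℝ)..x, w t) (x : Icc (0 : ℝ) L) :
    evalAt hL x u = c + ∫ t in (0 : ℝ)..x, w t :=
  (contRep_spec hL u).eqOn hL ⟨continuousOn_primitive hL c w, h⟩ x.2

theorem ae_eq_primitive (hL : 0 < L) (u : H1 L) :
    ((u : L2I L) : ℝ → ℂ) =ᵐ[volume.restrict (Ioo (0 : ℝ) L)]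
      fun x => evalAt hL ⟨0, le_rfl, hL.le⟩ u + ∫ t in (0 : ℝ)..x, wderiv L u t := by
  obtain ⟨c, hc⟩ := (wderiv_spec u).exists_primitive hL
  rw [evalAt_eq_of_ae_eq hL hc ⟨0, le_rfl, hL.le⟩]
  simpa using hc

/-- The fundamental theorem of calculus in `H¹(0,L)`. -/
theorem evalAt_eq_add_integral (hL : 0 < L) (u : H1 L) (x : Icc (0 : ℝ) L) :
    evalAt hL x u = evalAt hL ⟨0, le_rfl, hL.le⟩ u + ∫ t in (0 : ℝ)..x, wderiv L u t :=
  evalAt_eq_of_ae_eq hL (ae_eq_primitive hL u) x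

/-- The function c + ∫₀ˣ w is continuous on [0,L], hence bounded and square integrable. Integration
by parts against a test function has no boundary term, so w is its weak derivative. First-order
equations in H¹(0,L) are solved this way. -/
theorem exists_wderiv_eq (hL : 0 < L) (w : L2I L) (c : ℂ) :
    ∃ u : H1 L, wderiv L u = w ∧ evalAt hL ⟨0, le_rfl, hL.le⟩ u = c := by
  let W : ℝ → ℂ := fun x => c + ∫ t in (0 : ℝ)..x, w t
  have hW : ContinuousOn W (Icc 0 L) := continuousOn_primitive hL c w
  obtain ⟨C, hC⟩ := isCompact_Icc.exists_bound_of_continuousOn hW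
  have hWm : MemLp W 2 (volume.restrict (Ioo (0 : ℝ) L)) := by
    refine MemLp.of_bound ((hW.mono Ioo_subset_Icc_self).aestronglyMeasurable measurableSet_Ioo)
      C ?_
    filter_upwards [ae_restrict_mem measurableSet_Ioo] with x hx
    exact hC x (Ioo_subset_Icc_self hx)
  have hweak : IsWeakDeriv (hWm.toLp W) w := by
    intro φ hφ
    have hdc : Continuous fun x => ((deriv φ x : ℝ) : ℂ) :=
      Complex.continuous_ofReal.comp hφ.deriv.smooth.continuous
    have hd : ∀ x, HasDerivAt (fun x => (φ x : ℂ)) ((deriv φ x : ℝ) : ℂ) x := fun x =>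
      ((hφ.smooth.differentiable (by simp)) x).hasDerivAt.ofReal_comp
    have h0 : φ 0 = 0 :=
      image_eq_zero_of_notMem_tsupport fun h => (lt_irrefl _ (hφ.supp h).1)
    have h1 : φ L = 0 :=
      image_eq_zero_of_notMem_tsupport fun h => (lt_irrefl _ (hφ.supp h).2)
    have hp : ∀ x, ∫ t in (0 : ℝ)..x, ((deriv φ t : ℝ) : ℂ) = φ x := fun x => by
      rw [intervalIntegral.integral_eq_sub_of_hasDerivAt (fun t _ => hd t)
        (hdc.intervalIntegrable _ _), h0]
      simp
    have hwi := L2I.intervalIntegrable hL w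
    have hdi := hdc.intervalIntegrable (μ := volume) 0 L
    have h := integral_primitive_mul_add hdi hwi
    simp only [hp, h1, Complex.ofReal_zero, zero_mul] at h
    have e1 : ∫ x in Ioo 0 L, deriv φ x • (hWm.toLp W : ℝ → ℂ) x
        = ∫ x in (0 : ℝ)..L, (c * ((deriv φ x : ℝ) : ℂ)
          + (∫ t in (0 : ℝ)..x, w t) * ((deriv φ x : ℝ) : ℂ)) := by
      rw [intervalIntegral_eq_integral_Ioo hL]
      apply integral_congr_ae
      filter_upwards [hWm.coeFn_toLp] with x hx
      rw [hx, Complex.real_smul]; simp only [W]; ring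
    rw [e1, intervalIntegral.integral_add (hdi.const_mul c)
      (intervalIntegrable_primitive_mul hwi hdi), intervalIntegral.integral_const_mul, hp, h1,
      Complex.ofReal_zero, mul_zero, zero_add, eq_neg_iff_add_eq_zero, add_comm,
      ← intervalIntegral_eq_integral_Ioo hL]
    simpa only [Complex.real_smul] using h
  have hu : hWm.toLp W ∈ H1 L := ⟨w, hweak⟩
  refine ⟨⟨_, hu⟩, (wderiv_spec _).unique hweak, ?_⟩
  rw [evalAt_eq_of_ae_eq hL (u := ⟨_, hu⟩) (w := w) (c := c) hWm.coeFn_toLp]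
  simp

theorem exists_wderiv_eq_of_evalAt_right (hL : 0 < L) (w : L2I L) (c : ℂ) :
    ∃ u : H1 L, wderiv L u = w ∧ evalAt hL ⟨L, hL.le, le_rfl⟩ u = c := by
  obtain ⟨u, hu, hu0⟩ := exists_wderiv_eq hL w (c - ∫ t in (0 : ℝ)..L, w t)
  exact ⟨u, hu, by rw [evalAt_eq_add_integral, hu0, hu, sub_add_cancel]⟩

/-- Integration by parts in `H¹(0,L)`. -/
theorem inner_wderiv_add (hL : 0 < L) (u v : H1 L) (hu : evalAt hL ⟨0, le_rfl, hL.le⟩ u = 0) :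
    inner ℂ (u : L2I L) (wderiv L v) + inner ℂ (wderiv L u) (v : L2I L)
      = star (evalAt hL ⟨L, hL.le, le_rfl⟩ u) * evalAt hL ⟨L, hL.le, le_rfl⟩ v := by
  have e : ∀ u w : L2I L, inner ℂ u w = ∫ x in Ioo 0 L, w x * star (u x) := fun u w => rfl
  set a := wderiv L u with ha
  set b := wderiv L v with hb
  set c := evalAt hL ⟨0, le_rfl, hL.le⟩ v with hc
  have hai : IntervalIntegrable (fun x => star (a x)) volume 0 L :=
    intervalIntegrable_clm_comp (Complex.conjCLE : ℂ →L[ℝ] ℂ) (L2I.intervalIntegrable hL a)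
  have hbi := L2I.intervalIntegrable hL b
  have hs : ∀ x ∈ Icc 0 L, star (∫ t in (0 : ℝ)..x, a t) = ∫ t in (0 : ℝ)..x, star (a t) := by
    intro x hx
    exact ((Complex.conjCLE : ℂ →L[ℝ] ℂ).intervalIntegral_comp_comm
      ((L2I.intervalIntegrable hL a).mono_set
        (uIcc_subset_uIcc_left (by rwa [uIcc_of_le hL.le])))).symm
  have h := integral_primitive_mul_add hai hbi
  have e1 : inner ℂ (u : L2I L) b
      = ∫ x in (0 : ℝ)..L, (∫ t in (0 : ℝ)..x, star (a t)) * b x := by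
    rw [e, intervalIntegral_eq_integral_Ioo hL]
    apply integral_congr_ae
    filter_upwards [ae_eq_primitive hL u, ae_restrict_mem measurableSet_Ioo] with x hx hx'
    rw [hx, hu, zero_add, hs x (Ioo_subset_Icc_self hx'), mul_comm]
  have e2 : inner ℂ a (v : L2I L) = ∫ x in (0 : ℝ)..L, (c * star (a x)
      + (∫ t in (0 : ℝ)..x, b t) * star (a x)) := by
    rw [e, intervalIntegral_eq_integral_Ioo hL]
    apply integral_congr_ae
    filter_upwards [ae_eq_primitive hL v] with x hx
    rw [hx, add_mul]
  rw [e1, e2, intervalIntegral.integral_add (hai.const_mul c)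
    (intervalIntegrable_primitive_mul hbi hai), intervalIntegral.integral_const_mul,
    evalAt_eq_add_integral hL u, evalAt_eq_add_integral hL v, hu, zero_add,
    hs L ⟨hL.le, le_rfl⟩, ← hb, ← hc]
  linear_combination h

end Primitive

variable {p : Params}

/-! ### Completeness of the state space. -/

theorem State.norm_sq_eq (U : State p) : ‖U‖ ^ 2 =
    p.ρ * ‖U.f‖ ^ 2 + p.μ * ‖U.g‖ ^ 2 + p.α₁ * ‖U.Vx‖ ^ 2
      + p.β * ‖(p.γ : ℂ) • U.Vx - U.Px‖ ^ 2
      + p.κ * (p.l₁ * ‖U.φ₁‖ ^ 2 + p.l₂ * ‖U.φ₂‖ ^ 2) := by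
  rw [← State.re_inner_self, ← State.inner_eq]
  exact (inner_self_eq_norm_sq (𝕜 := ℂ) U).symm

/-- The components `(f, g, V_x, γ V_x - P_x, φ₁, φ₂)` in which the norm of the state space is a
weighted sum of squares. -/
noncomputable def State.energyComponents (p : Params) :
    State p →ₗ[ℂ] L2I p.L × L2I p.L × L2I p.L × L2I p.L × L2R × L2R where
  toFun U := (U.f, U.g, U.Vx, (p.γ : ℂ) • U.Vx - U.Px, U.φ₁, U.φ₂)
  map_add' U W := by
    simp only [State.f_add, State.g_add, State.Vx_add, State.Px_add, State.φ₁_add, State.φ₂_add,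
      smul_add, add_sub_add_comm, Prod.mk_add_mk]
  map_smul' c U := by
    simp only [State.f_smul, State.g_smul, State.Vx_smul, State.Px_smul, State.φ₁_smul,
      State.φ₂_smul, RingHom.id_apply, Prod.smul_mk, smul_sub, smul_comm c (p.γ : ℂ)]

/-- The map (V_x, P_x) ↦ (V_x, γV_x - P_x) is triangular and invertible, and V and P are recovered
from their derivatives because they vanish at 0. -/
theorem State.energyComponents_bijective (p : Params) :
    Function.Bijective (State.energyComponents p) := by
  constructor
  · rw [← LinearMap.ker_eq_bot, LinearMap.ker_eq_bot']
    intro U hU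
    have h : (U.f, U.g, U.Vx, (p.γ : ℂ) • U.Vx - U.Px, U.φ₁, U.φ₂) = 0 := hU
    simp only [Prod.mk_eq_zero] at h
    obtain ⟨h1, h2, h3, h4, h5, h6⟩ := h
    rw [h3, smul_zero, zero_sub, neg_eq_zero] at h4
    exact State.ext (eq_zero_of_wderiv_eq_zero p.L_pos _ h3 U.1.2) h1 h5
      (eq_zero_of_wderiv_eq_zero p.L_pos _ h4 U.2.2.2.1.2) h2 h6
  · rintro ⟨f, g, v, q, φ₁, φ₂⟩
    obtain ⟨V, hV, hV0⟩ := exists_wderiv_eq p.L_pos v 0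
    obtain ⟨P, hP, hP0⟩ := exists_wderiv_eq p.L_pos ((p.γ : ℂ) • v - q) 0
    refine ⟨((⟨V, hV0⟩, f, φ₁, ⟨P, hP0⟩, g, φ₂) :
      H1Star p.L_pos × L2I p.L × L2R × H1Star p.L_pos × L2I p.L × L2R), ?_⟩
    change (f, g, wderiv p.L V, (p.γ : ℂ) • wderiv p.L V - wderiv p.L P, φ₁, φ₂) = _
    rw [hV, hP, sub_sub_cancel]

/-- The energy norm is equivalent to the product norm on the six L² components, and that product is
complete. -/
instance : CompleteSpace (State p) := by
  have h1 := p.ρ_pos; have h2 := p.μ_pos; have h3 := p.α₁_pos; have h4 := p.β_pos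
  have h5 := mul_pos p.κ_pos p.l₁_pos; have h6 := mul_pos p.κ_pos p.l₂_pos
  let e := LinearEquiv.ofBijective _ (State.energyComponents_bijective p)
  have he : ∀ U : State p, e U = (U.f, U.g, U.Vx, (p.γ : ℂ) • U.Vx - U.Px, U.φ₁, U.φ₂) :=
    fun U => rfl
  obtain ⟨m, hm, m1, m2, m3, m4, m5, m6⟩ : ∃ m, 0 < m ∧ m ≤ p.ρ ∧ m ≤ p.μ ∧ m ≤ p.α₁ ∧ m ≤ p.β ∧
      m ≤ p.κ * p.l₁ ∧ m ≤ p.κ * p.l₂ := by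
    refine ⟨min p.ρ (min p.μ (min p.α₁ (min p.β (min (p.κ * p.l₁) (p.κ * p.l₂))))), ?_, ?_⟩
    · simp only [lt_min_iff]; exact ⟨h1, h2, h3, h4, h5, h6⟩
    · simp
  -- The product carries the sup norm: the smallest weight m bounds each component by ‖U‖, and the
  -- sum K of the weights bounds ‖U‖ by the largest component.
  set K := p.ρ + p.μ + p.α₁ + p.β + p.κ * p.l₁ + p.κ * p.l₂ with hK
  have hto : ∀ U, ‖e U‖ ≤ (√m)⁻¹ * ‖U‖ := by
    intro U
    have key : ∀ r : ℝ, 0 ≤ r → m * r ^ 2 ≤ ‖U‖ ^ 2 → r ≤ (√m)⁻¹ * ‖U‖ := by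
      intro r hr h
      rw [inv_mul_eq_div, le_div_iff₀ (Real.sqrt_pos.2 hm)]
      refine abs_le_of_sq_le_sq' ?_ (norm_nonneg U) |>.2
      rw [mul_pow, Real.sq_sqrt hm.le]; linarith
    have hn := State.norm_sq_eq U
    have q1 := sq_nonneg ‖U.f‖
    have q2 := sq_nonneg ‖U.g‖
    have q3 := sq_nonneg ‖U.Vx‖
    have q4 := sq_nonneg ‖(p.γ : ℂ) • U.Vx - U.Px‖
    have q5 := sq_nonneg ‖U.φ₁‖
    have q6 := sq_nonneg ‖U.φ₂‖
    have r1 := mul_nonneg h1.le q1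
    have r2 := mul_nonneg h2.le q2
    have r3 := mul_nonneg h3.le q3
    have r4 := mul_nonneg h4.le q4
    have r5 := mul_nonneg h5.le q5
    have r6 := mul_nonneg h6.le q6
    have s1 := mul_le_mul_of_nonneg_right m1 q1
    have s2 := mul_le_mul_of_nonneg_right m2 q2
    have s3 := mul_le_mul_of_nonneg_right m3 q3
    have s4 := mul_le_mul_of_nonneg_right m4 q4
    have s5 := mul_le_mul_of_nonneg_right m5 q5
    have s6 := mul_le_mul_of_nonneg_right m6 q6
    rw [he]
    simp only [norm_prod_le_iff]
    refine ⟨?_, ?_, ?_, ?_, ?_, ?_⟩ <;> refine key _ (norm_nonneg _) ?_ <;> linarith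
  have hinv : ∀ y, ‖e.symm y‖ ≤ √K * ‖y‖ := by
    intro y
    obtain ⟨U, rfl⟩ := e.surjective y
    rw [e.symm_apply_apply]
    have hn := State.norm_sq_eq U
    have key : ‖e U‖ ≤ ‖e U‖ := le_rfl
    nth_rw 1 [he] at key
    simp only [norm_prod_le_iff] at key
    obtain ⟨k1, k2, k3, k4, k5, k6⟩ := key
    have sq : ∀ {r : ℝ}, 0 ≤ r → r ≤ ‖e U‖ → r ^ 2 ≤ ‖e U‖ ^ 2 := fun hr h =>
      pow_le_pow_left₀ hr h 2
    have s1 := mul_le_mul_of_nonneg_left (sq (norm_nonneg _) k1) h1.le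
    have s2 := mul_le_mul_of_nonneg_left (sq (norm_nonneg _) k2) h2.le
    have s3 := mul_le_mul_of_nonneg_left (sq (norm_nonneg _) k3) h3.le
    have s4 := mul_le_mul_of_nonneg_left (sq (norm_nonneg _) k4) h4.le
    have s5 := mul_le_mul_of_nonneg_left (sq (norm_nonneg _) k5) h5.le
    have s6 := mul_le_mul_of_nonneg_left (sq (norm_nonneg _) k6) h6.le
    refine abs_le_of_sq_le_sq' ?_ (by positivity) |>.2
    rw [mul_pow, Real.sq_sqrt (by positivity), hn, hK]
    linarith
  let E := e.toContinuousLinearEquivOfBounds (√m)⁻¹ (√K) hto hinv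
  exact (completeSpace_congr (e := E.toEquiv) E.isUniformEmbedding).2 inferInstance

/-! ### The diffusive variables φ₁ and φ₂. -/

/-- Pointwise the integrand is -(ξ² + η)|φ|² plus the coupling term, and the first summand is
dropped. Comparing the integrands means its integrability is never needed. -/
theorem re_inner_diffusion_le {c : ℂ} {φ : L2R}
    (hφ : MemLp (fun ξ : ℝ => ((|ξ| : ℝ) : ℂ) * φ ξ) 2 volume)
    (hd : MemLp (diffusion p c φ) 2 volume) :
    (inner ℂ φ (hd.toLp _)).re ≤ (c * star (∫ ξ : ℝ, (p.kern ξ : ℂ) * φ ξ)).re := by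
  have e : ∀ u w : L2R, inner ℂ u w = ∫ x, w x * star (u x) := fun u w => rfl
  have i : Integrable fun ξ => hd.toLp _ ξ * star (φ ξ) := L2.integrable_inner φ (hd.toLp _)
  have hk := integrable_kern_mul p hφ
  have hk' : Integrable fun ξ => c * star ((p.kern ξ : ℂ) * φ ξ) :=
    ((Complex.conjCLE : ℂ →L[ℝ] ℂ).integrable_comp hk).const_mul c
  have es : star (∫ ξ : ℝ, (p.kern ξ : ℂ) * φ ξ) = ∫ ξ : ℝ, star ((p.kern ξ : ℂ) * φ ξ) :=
    ((Complex.conjCLE : ℂ →L[ℝ] ℂ).integral_comp_comm hk).symm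
  rw [e, es, ← integral_const_mul, ← Complex.reCLM_apply, ← Complex.reCLM_apply,
    ← Complex.reCLM.integral_comp_comm i, ← Complex.reCLM.integral_comp_comm hk']
  refine integral_mono_ae (Complex.reCLM.integrable_comp i) (Complex.reCLM.integrable_comp hk') ?_
  filter_upwards [hd.coeFn_toLp] with ξ hξ
  have hs : φ ξ * star (φ ξ) = ((‖φ ξ‖ ^ 2 : ℝ) : ℂ) := by
    rw [Complex.ofReal_pow]; exact Complex.mul_conj' _
  have h1 : diffusion p c φ ξ * star (φ ξ) = -((ξ ^ 2 + p.η) * ‖φ ξ‖ ^ 2 : ℝ)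
      + c * star ((p.kern ξ : ℂ) * φ ξ) := by
    have h2 : star ((p.kern ξ : ℂ) * φ ξ) = (p.kern ξ : ℂ) * star (φ ξ) := by
      rw [star_mul']; congr 1; exact Complex.conj_ofReal _
    rw [h2, Complex.ofReal_mul, ← hs, diffusion]; ring
  rw [hξ, h1, Complex.reCLM_apply, Complex.reCLM_apply, Complex.add_re, Complex.neg_re,
    Complex.ofReal_re]
  have := p.η_pos
  have : 0 ≤ (ξ ^ 2 + p.η) * ‖φ ξ‖ ^ 2 := by positivity
  linarith

/-- Solve pointwise: φ = (cμ - F) / (ξ² + η). As μ itself is not square integrable, the numerator is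
written as (1 + |ξ|) d with d ∈ L². Boundedness of (1 + |ξ|)² / (ξ² + η), which needs η > 0, then
puts φ and |ξ|φ in L². -/
theorem exists_diffusion_eq (p : Params) (c : ℂ) (F : L2R) : ∃ φ : L2R,
    MemLp (fun ξ : ℝ => ((|ξ| : ℝ) : ℂ) * φ ξ) 2 volume ∧
      diffusion p c φ =ᵐ[volume] F := by
  have hη := p.η_pos
  have hpos : ∀ ξ : ℝ, 0 < ξ ^ 2 + p.η := fun ξ => by positivity
  have hpos' : ∀ ξ : ℝ, 0 < 1 + |ξ| := fun ξ => by positivity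
  let ψ : ℝ → ℂ := fun ξ => (c * (p.kern ξ : ℂ) - F ξ) / ((ξ ^ 2 + p.η : ℝ) : ℂ)
  let d : ℝ → ℂ := fun ξ => c * ((p.kern ξ / (1 + |ξ|) : ℝ) : ℂ) - F ξ / ((1 + |ξ| : ℝ) : ℂ)
  have hψm : AEStronglyMeasurable ψ volume := by
    have hk : Measurable p.kern := by unfold Params.kern; fun_prop
    refine AEStronglyMeasurable.div₀ ?_ ?_
    · exact ((Complex.measurable_ofReal.comp hk).const_mul c).aestronglyMeasurable.sub
        (Lp.aestronglyMeasurable F)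
    · exact (by fun_prop : Measurable fun ξ : ℝ => ((ξ ^ 2 + p.η : ℝ) : ℂ)).aestronglyMeasurable
  have hdm : MemLp d 2 volume := by
    have h1 : MemLp (fun ξ : ℝ => ((p.kern ξ / (1 + |ξ|) : ℝ) : ℂ)) 2 volume :=
      (memLp_kern p).ofReal
    refine (h1.const_mul c).sub ((Lp.memLp F).of_le ?_ ?_)
    · exact (Lp.aestronglyMeasurable F).div₀
        (by fun_prop : Measurable fun ξ : ℝ => ((1 + |ξ| : ℝ) : ℂ)).aestronglyMeasurable
    · refine Eventually.of_forall fun ξ => ?_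
      rw [norm_div, Complex.norm_real, Real.norm_of_nonneg (hpos' ξ).le]
      exact div_le_self (norm_nonneg _) (by linarith [abs_nonneg ξ])
  have hψd : ∀ ξ, ‖ψ ξ‖ = (1 + |ξ|) / (ξ ^ 2 + p.η) * ‖d ξ‖ := by
    intro ξ
    have h1 : ((1 + |ξ| : ℝ) : ℂ) ≠ 0 := by exact_mod_cast (hpos' ξ).ne'
    have h2 : ((ξ ^ 2 + p.η : ℝ) : ℂ) ≠ 0 := by exact_mod_cast (hpos ξ).ne'
    have h3 : ψ ξ = (((1 + |ξ|) / (ξ ^ 2 + p.η) : ℝ) : ℂ) * d ξ := by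
      simp only [ψ, d]
      rw [Complex.ofReal_div, Complex.ofReal_div]
      field_simp
    rw [h3, norm_mul, Complex.norm_real, Real.norm_of_nonneg]
    have := hpos ξ; have := hpos' ξ
    positivity
  -- The constant comes from (1 + |ξ|)² ≤ 2ξ² + 2, where ξ² and 1 are bounded by ξ² + η and (ξ² + η)
  -- / η.
  have hbd : ∀ ξ : ℝ, (1 + |ξ|) * (1 + |ξ|) ≤ (2 + 2 / p.η) * (ξ ^ 2 + p.η) := by
    intro ξ
    have h1 : (2 + 2 / p.η) * (ξ ^ 2 + p.η) = 2 * ξ ^ 2 + 2 * p.η + 2 * ξ ^ 2 / p.η + 2 := by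
      field_simp; ring
    have h2 : 0 ≤ 2 * ξ ^ 2 / p.η := by positivity
    rw [h1, ← sq_abs ξ]
    rw [← sq_abs ξ] at h2
    nlinarith [sq_nonneg (|ξ| - 1)]
  have hψ : MemLp ψ 2 volume := by
    refine hdm.of_le_mul hψm (c := 2 + 2 / p.η) (Eventually.of_forall fun ξ => ?_)
    rw [hψd]
    refine mul_le_mul_of_nonneg_right ?_ (norm_nonneg _)
    rw [div_le_iff₀ (hpos ξ)]
    nlinarith [hbd ξ, abs_nonneg ξ]
  have hψ' : MemLp (fun ξ : ℝ => ((|ξ| : ℝ) : ℂ) * ψ ξ) 2 volume := by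
    refine hdm.of_le_mul (AEStronglyMeasurable.mul
      (by fun_prop : Measurable fun ξ : ℝ => ((|ξ| : ℝ) : ℂ)).aestronglyMeasurable hψm)
      (c := 2 + 2 / p.η) (Eventually.of_forall fun ξ => ?_)
    rw [norm_mul, Complex.norm_real, Real.norm_eq_abs, abs_abs, hψd, ← mul_assoc,
      mul_div_assoc']
    refine mul_le_mul_of_nonneg_right ?_ (norm_nonneg _)
    rw [div_le_iff₀ (hpos ξ)]
    nlinarith [hbd ξ, abs_nonneg ξ]
  refine ⟨hψ.toLp ψ, (memLp_congr_ae ?_).1 hψ', ?_⟩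
  · filter_upwards [hψ.coeFn_toLp] with ξ hξ
    rw [hξ]
  · filter_upwards [hψ.coeFn_toLp] with ξ hξ
    have h2 : ((ξ ^ 2 + p.η : ℝ) : ℂ) ≠ 0 := by exact_mod_cast (hpos ξ).ne'
    rw [diffusion, hξ]
    simp only [ψ]
    rw [neg_mul, mul_div_cancel₀ _ h2]
    ring

/-! ### Dissipativity and surjectivity of the beam operator. -/

/-- The operator of the beam system is dissipative. -/
theorem re_inner_opFun_nonpos (U : State p) (h : MemDomain p U) :
    (inner ℂ U (opFun U h)).re ≤ 0 := by
  have hρ : (p.ρ : ℂ) ≠ 0 := by exact_mod_cast p.ρ_pos.ne'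
  have hμ : (p.μ : ℂ) ≠ 0 := by exact_mod_cast p.μ_pos.ne'
  have hα : (p.α : ℂ) = p.α₁ + p.γ ^ 2 * p.β := by exact_mod_cast p.α_eq
  set v : H1 p.L := ⟨U.Vx, h.Vx_mem⟩
  set q : H1 p.L := ⟨U.Px, h.Px_mem⟩
  set f : H1 p.L := ⟨U.f, h.f_mem⟩
  set g : H1 p.L := ⟨U.g, h.g_mem⟩
  -- σ and τ are the stresses whose values at L the boundary conditions prescribe.
  let σ : H1 p.L := (p.α : ℂ) • v - (p.γ * p.β : ℂ) • q
  let τ : H1 p.L := (p.β : ℂ) • q - (p.γ * p.β : ℂ) • v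
  have i1 := inner_wderiv_add p.L_pos f σ h.f_zero
  have i2 := inner_wderiv_add p.L_pos g τ h.g_zero
  have b1 : evalL p σ = -(p.l₁ * p.κ : ℂ) * ∫ ξ : ℝ, (p.kern ξ : ℂ) * U.φ₁ ξ := by
    rw [← h.bc₁]; simp only [σ, map_sub, map_smul, smul_eq_mul]; rfl
  have b2 : evalL p τ = -(p.l₂ * p.κ : ℂ) * ∫ ξ : ℝ, (p.kern ξ : ℂ) * U.φ₂ ξ := by
    rw [← h.bc₂]; simp only [τ, map_sub, map_smul, smul_eq_mul]; rfl
  change _ = star (evalL p f) * evalL p σ at i1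
  change _ = star (evalL p g) * evalL p τ at i2
  rw [b1] at i1
  rw [b2] at i2
  have d1 := re_inner_diffusion_le h.φ₁_mem h.diff₁_mem
  have d2 := re_inner_diffusion_le h.φ₂_mem h.diff₂_mem
  set I₁ := ∫ ξ : ℝ, (p.kern ξ : ℂ) * U.φ₁ ξ
  set I₂ := ∫ ξ : ℝ, (p.kern ξ : ℂ) * U.φ₂ ξ
  -- Because α = α₁ + γ²β, the elastic part α₁⟨V_x, f_x⟩ + β⟨γV_x - P_x, γf_x - g_x⟩ equals ⟨σ, f_x⟩
  -- + ⟨τ, g_x⟩. The weights ρ and μ cancel the denominators of the operator.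
  have key : inner ℂ U (opFun U h) = inner ℂ (f : L2I p.L) (wderiv p.L σ)
      + inner ℂ (g : L2I p.L) (wderiv p.L τ) + inner ℂ (σ : L2I p.L) (wderiv p.L f)
      + inner ℂ (τ : L2I p.L) (wderiv p.L g)
      + p.κ * (p.l₁ * inner ℂ U.φ₁ (h.diff₁_mem.toLp _)
        + p.l₂ * inner ℂ U.φ₂ (h.diff₂_mem.toLp _)) := by
    rw [State.inner_eq, State.energyInner_eq]
    have c1 : (opFun U h).f = ((p.α / p.ρ : ℝ) : ℂ) • wderiv p.L v
      - ((p.γ * p.β / p.ρ : ℝ) : ℂ) • wderiv p.L q := rfl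
    have c2 : (opFun U h).g = -((p.γ * p.β / p.μ : ℝ) : ℂ) • wderiv p.L v
      + ((p.β / p.μ : ℝ) : ℂ) • wderiv p.L q := rfl
    have c3 : (opFun U h).Vx = wderiv p.L f := rfl
    have c4 : (opFun U h).Px = wderiv p.L g := rfl
    have c5 : (opFun U h).φ₁ = h.diff₁_mem.toLp _ := rfl
    have c6 : (opFun U h).φ₂ = h.diff₂_mem.toLp _ := rfl
    have e1 : (σ : L2I p.L) = (p.α : ℂ) • U.Vx - (p.γ * p.β : ℂ) • U.Px := rfl
    have e2 : (τ : L2I p.L) = (p.β : ℂ) • U.Px - (p.γ * p.β : ℂ) • U.Vx := rfl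
    have e3 : (f : L2I p.L) = U.f := rfl
    have e4 : (g : L2I p.L) = U.g := rfl
    rw [c1, c2, c3, c4, c5, c6, e1, e2, e3, e4]
    simp only [σ, τ, map_sub, map_smul, inner_sub_left, inner_sub_right, inner_add_right,
      inner_smul_left, inner_smul_right, Complex.conj_ofReal, map_mul, inner_neg_right,
      neg_smul]
    rw [hα]
    push_cast
    rw [hα]
    field_simp
    ring
  have s1 : (inner ℂ (σ : L2I p.L) (wderiv p.L f)).re
      = (inner ℂ (wderiv p.L f) (σ : L2I p.L)).re := by
    rw [← inner_conj_symm, Complex.conj_re]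
  have s2 : (inner ℂ (τ : L2I p.L) (wderiv p.L g)).re
      = (inner ℂ (wderiv p.L g) (τ : L2I p.L)).re := by
    rw [← inner_conj_symm, Complex.conj_re]
  have r1 := congrArg Complex.re i1
  have r2 := congrArg Complex.re i2
  -- The boundary term at L is exactly the negative of the weighted upper bound for the diffusion
  -- term.
  have t1 : (star (evalL p f) * (-(p.l₁ * p.κ : ℂ) * I₁)).re
      = -(p.κ * (p.l₁ * (evalL p f * star I₁).re)) := by
    simp [Complex.mul_re, Complex.mul_im]; ring
  have t2 : (star (evalL p g) * (-(p.l₂ * p.κ : ℂ) * I₂)).re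
      = -(p.κ * (p.l₂ * (evalL p g * star I₂).re)) := by
    simp [Complex.mul_re, Complex.mul_im]; ring
  rw [t1, Complex.add_re] at r1
  rw [t2, Complex.add_re] at r2
  have m1 := mul_le_mul_of_nonneg_left (mul_le_mul_of_nonneg_left d1 p.l₁_pos.le) p.κ_pos.le
  have m2 := mul_le_mul_of_nonneg_left (mul_le_mul_of_nonneg_left d2 p.l₂_pos.le) p.κ_pos.le
  rw [key]
  simp only [Complex.add_re, Complex.re_ofReal_mul, s1, s2]
  linarith

/-- The stationary problem `𝒜 U = F` can be solved by two integrations. -/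
theorem exists_opFun_eq (F : State p) : ∃ (U : State p) (h : MemDomain p U), opFun U h = F := by
  have hρ : (p.ρ : ℂ) ≠ 0 := by exact_mod_cast p.ρ_pos.ne'
  have hμ : (p.μ : ℂ) ≠ 0 := by exact_mod_cast p.μ_pos.ne'
  have hβ : (p.β : ℂ) ≠ 0 := by exact_mod_cast p.β_pos.ne'
  have hα₁ : (p.α₁ : ℂ) ≠ 0 := by exact_mod_cast p.α₁_pos.ne'
  have hα : (p.α : ℂ) = p.α₁ + p.γ ^ 2 * p.β := by exact_mod_cast p.α_eq
  -- The first and fourth components of 𝒜U = F force f and g to be those of F, so f(L) and g(L) are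
  -- data and the diffusion equations decouple from V and P.
  obtain ⟨φ₁, hφ₁, hd₁⟩ := exists_diffusion_eq p (evalL p F.V) F.φ₁
  obtain ⟨φ₂, hφ₂, hd₂⟩ := exists_diffusion_eq p (evalL p F.P) F.φ₂
  obtain ⟨σ, hσ, hσL⟩ := exists_wderiv_eq_of_evalAt_right p.L_pos ((p.ρ : ℂ) • F.f)
    (-(p.l₁ * p.κ : ℂ) * ∫ ξ : ℝ, (p.kern ξ : ℂ) * φ₁ ξ)
  obtain ⟨τ, hτ, hτL⟩ := exists_wderiv_eq_of_evalAt_right p.L_pos ((p.μ : ℂ) • F.g)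
    (-(p.l₂ * p.κ : ℂ) * ∫ ξ : ℝ, (p.kern ξ : ℂ) * φ₂ ξ)
  -- These invert σ = αv - γβq, τ = βq - γβv: since α - γ²β = α₁, one has σ + γτ = α₁v.
  let v : H1 p.L := (p.α₁ : ℂ)⁻¹ • (σ + (p.γ : ℂ) • τ)
  let q : H1 p.L := (p.β : ℂ)⁻¹ • τ + (p.γ : ℂ) • v
  have hv : (p.α₁ : ℂ) • v = σ + (p.γ : ℂ) • τ := smul_inv_smul₀ hα₁ _
  have hq : (p.β : ℂ) • q = τ + (p.β : ℂ) • (p.γ : ℂ) • v := by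
    simp only [q, smul_add, smul_inv_smul₀ hβ]
  have hvq₁ : (p.α : ℂ) • v - (p.γ * p.β : ℂ) • q = σ := by
    rw [mul_smul, hq, hα, add_smul, hv]; module
  have hvq₂ : (p.β : ℂ) • q - (p.γ * p.β : ℂ) • v = τ := by
    rw [hq]; module
  clear_value v q
  -- The second integration starts at 0, which enforces V(0) = P(0) = 0.
  obtain ⟨V, hV, hV0⟩ := exists_wderiv_eq p.L_pos (v : L2I p.L) 0
  obtain ⟨P, hP, hP0⟩ := exists_wderiv_eq p.L_pos (q : L2I p.L) 0
  let U : State p := ((⟨V, hV0⟩, F.V, φ₁, ⟨P, hP0⟩, F.P, φ₂) :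
    H1Star p.L_pos × L2I p.L × L2R × H1Star p.L_pos × L2I p.L × L2R)
  have hVx : U.Vx = v := hV
  have hPx : U.Px = q := hP
  have hVm : U.Vx ∈ H1 p.L := hVx ▸ v.2
  have hPm : U.Px ∈ H1 p.L := hPx ▸ q.2
  have eV : (⟨U.Vx, hVm⟩ : H1 p.L) = v := Subtype.ext hVx
  have eP : (⟨U.Px, hPm⟩ : H1 p.L) = q := Subtype.ext hPx
  have h : MemDomain p U :=
    { Vx_mem := hVm
      Px_mem := hPm
      f_mem := F.V.2
      f_zero := F.1.2
      g_mem := F.P.2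
      g_zero := F.2.2.2.1.2
      φ₁_mem := hφ₁
      φ₂_mem := hφ₂
      diff₁_mem := (memLp_congr_ae hd₁).2 (Lp.memLp F.φ₁)
      diff₂_mem := (memLp_congr_ae hd₂).2 (Lp.memLp F.φ₂)
      bc₁ := by
        rw [eV, eP]
        refine Eq.trans ?_ hσL
        rw [← hvq₁, map_sub, map_smul, map_smul]; rfl
      bc₂ := by
        rw [eV, eP]
        refine Eq.trans ?_ hτL
        rw [← hvq₂, map_sub, map_smul, map_smul]; rfl }
  refine ⟨U, h, State.ext rfl ?_ ?_ rfl ?_ ?_⟩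
  · change ((p.α / p.ρ : ℝ) : ℂ) • wderiv p.L ⟨U.Vx, hVm⟩
      - ((p.γ * p.β / p.ρ : ℝ) : ℂ) • wderiv p.L ⟨U.Px, hPm⟩ = F.f
    rw [eV, eP, ← inv_smul_smul₀ hρ F.f, ← hσ, ← hvq₁, map_sub, map_smul, map_smul, smul_sub,
      smul_smul, smul_smul]
    push_cast
    simp only [div_eq_inv_mul]
  · exact Lp.ext (((memLp_congr_ae hd₁).2 (Lp.memLp F.φ₁)).coeFn_toLp.trans hd₁)
  · change -((p.γ * p.β / p.μ : ℝ) : ℂ) • wderiv p.L ⟨U.Vx, hVm⟩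
      + ((p.β / p.μ : ℝ) : ℂ) • wderiv p.L ⟨U.Px, hPm⟩ = F.g
    rw [eV, eP, ← inv_smul_smul₀ hμ F.g, ← hτ, ← hvq₂, map_sub, map_smul, map_smul, smul_sub,
      smul_smul, smul_smul]
    push_cast
    simp only [div_eq_inv_mul, neg_smul]
    abel
  · exact Lp.ext (((memLp_congr_ae hd₂).2 (Lp.memLp F.φ₂)).coeFn_toLp.trans hd₂)

end PiezoBeam

/-- Well-posedness of the augmented piezoelectric beam system `U_t = 𝒜 U`, `U(0) = U₀`. -/
theorem mainTheorem4 (p : PiezoBeam.Params) :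
    ∃ S : ℝ → PiezoBeam.State p →L[ℂ] PiezoBeam.State p,
      IsContractionSemigroup S ∧ IsGenerator (PiezoBeam.beamOp p) S ∧
        ∀ U₀ ∈ (PiezoBeam.beamOp p).domain,
          IsSolution (PiezoBeam.beamOp p) U₀ (fun t => S t U₀) ∧
          IsContinuousInDomain (PiezoBeam.beamOp p) (fun t => S t U₀) ∧
          ContDiffOn ℝ 1 (fun t => S t U₀) (Ici 0) ∧
          ∀ U : ℝ → PiezoBeam.State p, IsSolution (PiezoBeam.beamOp p) U₀ U →
            ∀ t, 0 ≤ t → U t = S t U₀ :=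
  exists_contractionSemigroup_isGenerator
    (fun U => PiezoBeam.re_inner_opFun_nonpos U.1 U.2) fun F => by
      obtain ⟨U, h, hU⟩ := PiezoBeam.exists_opFun_eq F
      exact ⟨⟨U, h⟩, hU⟩
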